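/- **Setting.** Let $G$ be a locally compact Hausdorff topological groupoid with range and source maps $r,s$ and unit space $G^{(0)}$, and put $G^u=r^{-1}(u)$. Let $\{\lambda^u\}_{u\in G^{(0)}}$ be a Haar system on $G$: each $\lambda^u$ is a Radon measure on $G$ with support $G^u$, the map $u\mapsto\int f\,d\lambda^u$ is continuous for all $f\in C_c(G)$, and $\int f(\gamma\eta)\,d\lambda^{s(\gamma)}(\eta)=\int f(\eta)\,d\lambda^{r(\gamma)}(\eta)$ for all $\gamma\in G$, $f\in C_c(G)$. For a compact Hausdorff abelian group $\Gamma$, a *$\Gamma$-twist over $G$* is a triple $(\Sigma,\iota,\pi)$, where $\Sigma$ is a locally compact Hausdorff topological groupoid, and $\iota:G^{(0)}\times\Gamma\to\Sigma$ (with $G^{(0)}\times\Gamma$ the trivial group bundle) and $\pi:\Sigma\to G$ are groupoid homomorphisms such that: $\iota$ is a homeomorphism onto its image; $\pi$ is a topological quotient map; $\Sigma^{(0)}=\iota(G^{(0)}\times\{e\})$ and $\pi(\iota(u,e))=u$ for $u\in G^{(0)}$ (this identifies $\Sigma^{(0)}$ with $G^{(0)}$); $\iota(G^{(0)}\times\Gamma)=\pi^{-1}(G^{(0)})$;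 and $\iota(r(\sigma),\alpha)\sigma=\sigma\,\iota(s(\sigma),\alpha)$ for all $\sigma\in\Sigma$, $\alpha\in\Gamma$. Write $\alpha\cdot\sigma:=\iota(r(\sigma),\alpha)\sigma$. Let $\lambda$ be the normalised Haar measure of $\Gamma$ and $\mathfrak s:G\to\Sigma$ any section of $\pi$. The formula $$\int_\Sigma f\,d\mu^u=\int_{G^u}\int_\Gamma f(\alpha\cdot\mathfrak s(\gamma))\,d\lambda(\alpha)\,d\lambda^u(\gamma)\qquad(f\in C_c(\Sigma))$$ defines Radon measures $\mu^u$ that form a Haar system on $\Sigma$; let $\mu_u$ be the image of $\mu^u$ under inversion; it is supported on $\Sigma_u=s^{-1}(u)$. With $$f*g(\sigma)=\int f(\tau)g(\tau^{-1}\sigma)\,d\mu^{r(\sigma)}(\tau),\qquad f^*(\sigma)=\overline{f(\sigma^{-1})},$$ $C_c(\Sigma)$ is a $*$-algebra. For a character $\chi$ of $\Gamma$ (a continuous homomorphism $\Gamma\to\mathbb T$), $$C_c(\Sigma;G;\chi)=\{f\in C_c(\Sigma): f(\alpha\cdot\sigma)=\chi(\alpha)f(\sigma)\text{ for all }\alpha\in\Gamma,\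 \sigma\in\Sigma\}$$ is a $*$-subalgebra. Let $\|f\|_I=\max\{\sup_u\int|f|\,d\mu_u,\ \sup_u\int|f|\,d\mu^u\}$. The *full norm* of $f\in C_c(\Sigma;G;\chi)$ is the supremum of $\|L(f)\|$ over all $*$-representations $L$ of $C_c(\Sigma;G;\chi)$ on Hilbert spaces with $\|L(g)\|\le\|g\|_I$ for all $g\in C_c(\Sigma;G;\chi)$; the *reduced norm* is $\sup_u\|\mathrm{Ind}\,\delta_u(f)\|$, where $\mathrm{Ind}\,\delta_u(f)$ is the bounded operator on $L^2(\Sigma_u,\mu_u)$ that extends $g\mapsto f*g$, $g\in C_c(\Sigma)$. The completions of $C_c(\Sigma;G;\chi)$ in these norms are the full $C^*$-algebra $C^*(\Sigma;G;\chi)$ and the reduced $C^*$-algebra $C^*_r(\Sigma;G;\chi)$. **Theorem.** Let $\Gamma,\Gamma'$ be compact Hausdorff abelian groups, let $(\Sigma,\iota,\pi)$ be a $\Gamma$-twist over $G$ and $(\Sigma',\iota',\pi')$ a $\Gamma'$-twist over the same $G$, let $\theta:\Gamma\to\Gamma'$ be a continuous group homomorphism and $\theta_1:\Sigma\to\Sigma'$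 a continuous groupoid homomorphism with $$\theta_1(\iota(u,\alpha))=\iota'(u,\theta(\alpha))\quad(u\in G^{(0)},\ \alpha\in\Gamma),\qquad \pi'\circ\theta_1=\pi .$$ Let $\chi'$ be a character of $\Gamma'$ and put $\chi=\chi'\circ\theta$. Then for every $f\in C_c(\Sigma;G;\chi)$ there is a unique $f'\in C_c(\Sigma';G;\chi')$ with $f'\circ\theta_1=f$. The map $\Upsilon:f\mapsto f'$ is a $*$-isomorphism $C_c(\Sigma;G;\chi)\to C_c(\Sigma';G;\chi')$, and it extends to $*$-isomorphisms $C^*(\Sigma;G;\chi)\cong C^*(\Sigma';G;\chi')$ and $C^*_r(\Sigma;G;\chi)\cong C^*_r(\Sigma';G;\chi')$. -/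

import Mathlib

open Set Filter Topology MeasureTheory CompactlySupported

set_option linter.unusedSectionVars false

universe u

noncomputable section

/-- A groupoid, presented by its set `G` of arrows; a unit is identified with its identity arrow,
so that source and range take values in `G`. The product `gmul a b` is only meaningful for
composable pairs, i.e. if `src a = rng b`; nothing is required of the other values. -/
class ArrowGroupoid (G : Type*) where
  src : G → G
  rng : G → G
  gmul : G → G → G
  ginv : G → G
  src_src : ∀ a, src (src a) = src a
  rng_src : ∀ a, rng (src a) = src a
  src_rng : ∀ a, src (rng a) = rng a
  rng_rng : ∀ a, rng (rng a) = rng a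
  src_gmul : ∀ a b, src a = rng b → src (gmul a b) = src b
  rng_gmul : ∀ a b, src a = rng b → rng (gmul a b) = rng a
  gmul_assoc : ∀ a b c, src a = rng b → src b = rng c →
    gmul (gmul a b) c = gmul a (gmul b c)
  gmul_src : ∀ a, gmul a (src a) = a
  rng_gmul_self : ∀ a, gmul (rng a) a = a
  src_ginv : ∀ a, src (ginv a) = rng a
  rng_ginv : ∀ a, rng (ginv a) = src a
  ginv_gmul : ∀ a, gmul (ginv a) a = src a
  gmul_ginv : ∀ a, gmul a (ginv a) = rng a

open ArrowGroupoid

infixl:70 " ⋄ " => ArrowGroupoid.gmul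

/-- A topological groupoid: inversion is continuous, and multiplication is continuous on the set
of composable pairs. (Source and range are then continuous too.) -/
class IsTopologicalGroupoid (G : Type*) [TopologicalSpace G] [ArrowGroupoid G] : Prop where
  continuous_ginv : Continuous (ginv : G → G)
  continuousOn_gmul : ContinuousOn (fun p : G × G => p.1 ⋄ p.2) {p | src p.1 = rng p.2}

/-- The unit space `G⁽⁰⁾`. -/
def unitSpace (G : Type*) [ArrowGroupoid G] : Set G := {u | src u = u}

/-- A groupoid homomorphism. -/
def IsGroupoidHom {G H : Type*} [ArrowGroupoid G] [ArrowGroupoid H] (φ : G → H) : Prop :=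
  ∀ a b, src a = rng b → src (φ a) = rng (φ b) ∧ φ (a ⋄ b) = φ a ⋄ φ b

section Groupoid

variable {G : Type*} [ArrowGroupoid G]

/-- The source, as an element of the unit space. -/
def srcU (a : G) : unitSpace G := ⟨src a, src_src a⟩

/-- The range, as an element of the unit space. -/
def rngU (a : G) : unitSpace G := ⟨rng a, src_rng a⟩

theorem rng_unit (u : unitSpace G) : rng (u : G) = u := by
  have h : src (u : G) = u := u.2
  rw [← h, rng_src]

theorem src_unit (u : unitSpace G) : src (u : G) = u := u.2

theorem ginv_gmul_cancel (a b : G) (h : src a = rng b) : ginv a ⋄ (a ⋄ b) = b := by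
  rw [← gmul_assoc _ _ _ (src_ginv a) h, ginv_gmul, h, rng_gmul_self]

theorem gmul_ginv_cancel (a b : G) (h : rng a = rng b) : a ⋄ (ginv a ⋄ b) = b := by
  rw [← gmul_assoc _ _ _ (rng_ginv a).symm (by rw [src_ginv, h]), gmul_ginv, h, rng_gmul_self]

theorem eq_ginv_of_gmul (a b : G) (h : src a = rng b) (h1 : a ⋄ b = rng a) : b = ginv a := by
  rw [← ginv_gmul_cancel a b h, h1, ← src_ginv a, gmul_src]

theorem ginv_ginv (a : G) : ginv (ginv a) = a :=
  (eq_ginv_of_gmul _ _ (src_ginv a) (by rw [ginv_gmul, rng_ginv])).symm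

theorem ginv_gmul_rev (a b : G) (h : src a = rng b) : ginv (a ⋄ b) = ginv b ⋄ ginv a := by
  have h1 : src (ginv b) = rng (ginv a) := by rw [src_ginv, rng_ginv, h]
  refine (eq_ginv_of_gmul _ _ ?_ ?_).symm
  · rw [src_gmul _ _ h, rng_gmul _ _ h1, rng_ginv]
  · rw [rng_gmul _ _ h, gmul_assoc _ _ _ h (by rw [rng_gmul _ _ h1, rng_ginv]),
      gmul_ginv_cancel b _ (by rw [rng_ginv, h]), gmul_ginv]

theorem rng_hom {H : Type*} [ArrowGroupoid H] {φ : G → H} (hφ : IsGroupoidHom φ) (a : G) :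
    rng (φ a) = φ (rng a) := by
  obtain ⟨h1, h2⟩ := hφ (rng a) a (src_rng a)
  obtain ⟨h3, h4⟩ := hφ (rng a) (rng a) (by rw [src_rng, rng_rng])
  have h5 : rng a ⋄ rng a = rng a := by
    conv_lhs => rw [← src_rng a]
    rw [src_rng]
    conv_lhs => arg 1; rw [← rng_rng a]
    exact rng_gmul_self _
  rw [h5] at h4
  have h6 := ginv_gmul_cancel _ _ h3
  rw [← h4, ginv_gmul] at h6
  rw [← h1, h6]

theorem src_hom {H : Type*} [ArrowGroupoid H] {φ : G → H} (hφ : IsGroupoidHom φ) (a : G) :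
    src (φ a) = φ (src a) := by
  obtain ⟨h1, h2⟩ := hφ a (src a) (rng_src a).symm
  rw [h1, rng_hom hφ, rng_src]

variable [TopologicalSpace G] [IsTopologicalGroupoid G]

theorem continuous_ginv' : Continuous (ginv : G → G) := IsTopologicalGroupoid.continuous_ginv

theorem Continuous.gmul {X : Type*} [TopologicalSpace X] {f g : X → G} (hf : Continuous f)
    (hg : Continuous g) (h : ∀ x, src (f x) = rng (g x)) : Continuous fun x => f x ⋄ g x :=
  IsTopologicalGroupoid.continuousOn_gmul.comp_continuous (hf.prodMk hg) h

theorem continuous_src : Continuous (src : G → G) := by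
  have : (src : G → G) = fun a => ginv a ⋄ a := by ext a; rw [ginv_gmul]
  rw [this]
  exact continuous_ginv'.gmul continuous_id fun x => src_ginv x

theorem continuous_rng : Continuous (rng : G → G) := by
  have : (rng : G → G) = fun a => a ⋄ ginv a := by ext a; rw [gmul_ginv]
  rw [this]
  exact continuous_id.gmul continuous_ginv' fun x => (rng_ginv x).symm

theorem continuous_rngU : Continuous (rngU : G → unitSpace G) := continuous_rng.subtype_mk _

theorem continuous_srcU : Continuous (srcU : G → unitSpace G) := continuous_src.subtype_mk _

/-- Inversion as a homeomorphism. -/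
def ginvHomeo (G : Type*) [ArrowGroupoid G] [TopologicalSpace G] [IsTopologicalGroupoid G] :
    G ≃ₜ G where
  toFun := ginv
  invFun := ginv
  left_inv := ginv_ginv
  right_inv := ginv_ginv
  continuous_toFun := continuous_ginv'
  continuous_invFun := continuous_ginv'

/-- The arrows with range `u`. -/
abbrev Fib (u : unitSpace G) : Type _ := {γ : G // rng γ = (u : G)}

theorem isClosed_fib [T2Space G] (u : unitSpace G) : IsClosed {γ : G | rng γ = (u : G)} :=
  isClosed_eq continuous_rng continuous_const

/-- The product of two compact sets of arrows is compact. -/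
theorem isCompact_gmul [T2Space G] {K L : Set G} (hK : IsCompact K) (hL : IsCompact L) :
    IsCompact ((fun p : G × G => p.1 ⋄ p.2) '' ((K ×ˢ L) ∩ {p | src p.1 = rng p.2})) := by
  refine IsCompact.image_of_continuousOn ?_
    (IsTopologicalGroupoid.continuousOn_gmul.mono inter_subset_right)
  exact (hK.prod hL).inter_right
    (isClosed_eq (continuous_src.comp continuous_fst) (continuous_rng.comp continuous_snd))

end Groupoid

/-- Extension of compactly supported continuous functions from closed subspaces. -/
theorem exists_cc_extension {X Y : Type*} [TopologicalSpace X] [TopologicalSpace Y]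
    [T2Space Y] [LocallyCompactSpace Y] {e : X → Y} (he : IsClosedEmbedding e) {f : X → ℂ}
    (hf : Continuous f) (hfc : HasCompactSupport f) :
    ∃ F : C_c(Y, ℂ), ∀ x, F (e x) = f x := by
  obtain ⟨φ, h1, -, h3, -⟩ := exists_continuous_one_zero_of_isCompact
    (hfc.isCompact.image he.continuous) isClosed_empty (disjoint_empty _)
  have hφK : IsCompact (e ⁻¹' tsupport φ) := he.isCompact_preimage h3
  -- extend over the one-point compactification
  let A : Set X := e ⁻¹' tsupport φ
  have : CompactSpace A := isCompact_iff_compactSpace.1 hφK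
  let j : A → OnePoint Y := fun x => ((e x : Y) : OnePoint Y)
  have hj : IsClosedEmbedding j := by
    refine Continuous.isClosedEmbedding ?_ ?_
    · exact OnePoint.continuous_coe.comp (he.continuous.comp continuous_subtype_val)
    · intro x y hxy
      exact Subtype.ext (he.injective (OnePoint.coe_injective hxy))
  obtain ⟨g, hg⟩ := ContinuousMap.exists_extension hj
    (⟨fun x : A => f x, hf.comp continuous_subtype_val⟩ : C(A, ℂ))
  refine ⟨⟨⟨fun y => (φ y : ℂ) * g (y : OnePoint Y), ?_⟩, ?_⟩, ?_⟩
  · exact (Complex.continuous_ofReal.comp φ.continuous).mul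
      (g.continuous.comp OnePoint.continuous_coe)
  · refine HasCompactSupport.mul_right (f := fun y => (φ y : ℂ)) ?_
    exact h3.comp_left (g := fun r : ℝ => (r : ℂ)) Complex.ofReal_zero
  · intro x
    show (φ (e x) : ℂ) * g ((e x : Y) : OnePoint Y) = f x
    by_cases hx : x ∈ A
    · have h4 : g ((e x : Y) : OnePoint Y) = f x := congrArg (fun h : C(A, ℂ) => h ⟨x, hx⟩) hg
      rw [h4]
      by_cases hx2 : f x = 0
      · simp [hx2]
      · have : φ (e x) = 1 := h1 (mem_image_of_mem e (subset_tsupport _ hx2))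
        simp [this]
    · have h5 : φ (e x) = 0 := image_eq_zero_of_notMem_tsupport hx
      have h6 : f x = 0 := by
        by_contra h
        have : φ (e x) = 1 := h1 (mem_image_of_mem e (subset_tsupport _ h))
        rw [h5] at this
        exact zero_ne_one this
      simp [h5, h6]

/-- A (left) Haar system on a locally compact Hausdorff groupoid: Radon measures `λᵘ` on `G`,
indexed by the units `u`, with support `{γ | r(γ) = u}`, depending continuously on `u`, and left
invariant. -/
structure HaarSystem (G : Type*) [TopologicalSpace G] [T2Space G] [LocallyCompactSpace G]
    [MeasurableSpace G] [BorelSpace G] [ArrowGroupoid G] [IsTopologicalGroupoid G] where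
  meas : unitSpace G → Measure G
  regular : ∀ u, (meas u).Regular
  support_eq : ∀ u, (meas u).support = {γ | rng γ = (u : G)}
  continuous_integral : ∀ f : C_c(G, ℂ), Continuous fun u => ∫ γ, f γ ∂meas u
  left_inv : ∀ (γ : G) (f : C_c(G, ℂ)),
    ∫ η, f (γ ⋄ η) ∂meas (srcU γ) = ∫ η, f η ∂meas (rngU γ)

namespace HaarSystem

variable {G : Type*} [TopologicalSpace G] [T2Space G] [LocallyCompactSpace G]
    [MeasurableSpace G] [BorelSpace G] [ArrowGroupoid G] [IsTopologicalGroupoid G]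
    (H : HaarSystem G)

instance (u : unitSpace G) : (H.meas u).Regular := H.regular u

theorem ae_fib (u : unitSpace G) : ∀ᵐ γ ∂H.meas u, rng γ = (u : G) := by
  have h := Measure.support_mem_ae_of_regular (μ := H.meas u)
  rw [H.support_eq] at h
  exact h

/-- The measure `λᵘ` on the set of arrows with range `u`. -/
def fm (u : unitSpace G) : Measure (Fib u) := (H.meas u).comap Subtype.val

instance (u : unitSpace G) : IsFiniteMeasureOnCompacts (H.fm u) where
  lt_top_of_isCompact K hK := by
    have hm := (isClosed_fib u).measurableSet
    exact ((MeasurableEmbedding.subtype_coe hm).comap_apply (H.meas u) K).trans_lt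
      (hK.image continuous_subtype_val).measure_lt_top

theorem integral_fm {E : Type*} [NormedAddCommGroup E] [NormedSpace ℝ E] (u : unitSpace G)
    (h : G → E) : ∫ x : Fib u, h x ∂H.fm u = ∫ γ, h γ ∂H.meas u := by
  have hm := (isClosed_fib u).measurableSet
  have h1 := integral_subtype_comap (μ := H.meas u) hm h
  have h2 : (H.meas u).restrict {γ : G | rng γ = (u : G)} = H.meas u :=
    Measure.restrict_eq_self_of_ae_mem (H.ae_fib u)
  rw [h2] at h1
  exact h1

instance locallyCompactSpace_fib (u : unitSpace G) : LocallyCompactSpace (Fib u) :=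
  (isClosed_fib u).isClosedEmbedding_subtypeVal.locallyCompactSpace

/-- Left invariance, for functions which are only continuous on one fibre. -/
theorem left_inv' (γ : G) (h : G → ℂ) (hc : Continuous fun x : Fib (rngU γ) => h x)
    (hs : HasCompactSupport fun x : Fib (rngU γ) => h x) :
    ∫ η, h (γ ⋄ η) ∂H.meas (srcU γ) = ∫ η, h η ∂H.meas (rngU γ) := by
  obtain ⟨F, hF⟩ := exists_cc_extension
    (isClosed_fib (rngU γ)).isClosedEmbedding_subtypeVal hc hs
  have h1 := H.left_inv γ F
  rw [integral_congr_ae (g := fun η => h (γ ⋄ η)),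
    integral_congr_ae (μ := H.meas (rngU γ)) (g := h)] at h1
  · exact h1
  · filter_upwards [H.ae_fib (rngU γ)] with η hη using hF ⟨η, hη⟩
  · filter_upwards [H.ae_fib (srcU γ)] with η hη
    exact hF ⟨γ ⋄ η, rng_gmul _ _ hη.symm⟩

theorem continuous_integral_prod {X : Type*} [TopologicalSpace X] (F : C_c(X × G, ℂ)) :
    Continuous fun p : unitSpace G × X => ∫ τ, F (p.2, τ) ∂H.meas p.1 := by
  let K : Set G := Prod.snd '' tsupport F
  have hK : IsCompact K := F.hasCompactSupport.isCompact.image continuous_snd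
  have hFK : ∀ x τ, τ ∉ K → F (x, τ) = 0 := fun x τ h => by
    by_contra h1
    exact h ⟨(x, τ), subset_tsupport _ h1, rfl⟩
  obtain ⟨φ, h1, -, h3, h4⟩ := exists_continuous_one_zero_of_isCompact hK isClosed_empty
    (disjoint_empty _)
  let Φ : C_c(G, ℂ) := ⟨⟨fun τ => (φ τ : ℂ), by fun_prop⟩,
    h3.comp_left (g := fun r : ℝ => (r : ℂ)) Complex.ofReal_zero⟩
  have hsl : ∀ x, HasCompactSupport fun τ => F (x, τ) := fun x =>
    HasCompactSupport.intro hK fun τ h => hFK x τ h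
  let S : X → C_c(G, ℂ) := fun x => ⟨⟨fun τ => F (x, τ), by fun_prop⟩, hsl x⟩
  rw [continuous_iff_continuousAt]
  rintro ⟨u₀, x₀⟩
  have hΦ := H.continuous_integral Φ
  have hΦr : ∀ u, ∫ τ, Φ τ ∂H.meas u = ((∫ τ, φ τ ∂H.meas u : ℝ) : ℂ) := fun u =>
    integral_ofReal
  set c : unitSpace G → ℝ := fun u => ∫ τ, φ τ ∂H.meas u with hc
  have hcc : Continuous c := by
    have : c = fun u => (∫ τ, Φ τ ∂H.meas u).re := by ext u; rw [hΦr]; simp [hc]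
    rw [this]; exact Complex.continuous_re.comp hΦ
  have hφi : ∀ u, Integrable (fun τ => φ τ) (H.meas u) := fun u =>
    φ.continuous.integrable_of_hasCompactSupport h3
  have hFi : ∀ u x, Integrable (fun τ => F (x, τ)) (H.meas u) := fun u x =>
    (S x).continuous.integrable_of_hasCompactSupport (hsl x)
  have hc0 : ∀ u, 0 ≤ c u := fun u => integral_nonneg fun τ => (h4 τ).1
  rw [ContinuousAt, Metric.tendsto_nhds]
  intro ε hε
  -- uniform closeness in the second variable
  set δ : ℝ := ε / (2 * (c u₀ + 1)) with hδ
  have hc1 : 0 < c u₀ + 1 := by linarith [hc0 u₀]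
  have hδ0 : 0 < δ := by positivity
  have hU : ∀ᶠ x in 𝓝 x₀, ∀ τ ∈ K, ‖F (x, τ) - F (x₀, τ)‖ < δ := by
    refine hK.eventually_forall_of_forall_eventually fun τ _ => ?_
    have : ContinuousAt (fun p : X × G => ‖F (p.1, p.2) - F (x₀, p.2)‖) (x₀, τ) :=
      (F.continuous.sub (F.continuous.comp (by fun_prop :
        Continuous fun p : X × G => (x₀, p.2)))).norm.continuousAt
    refine this.eventually_lt continuousAt_const ?_
    simpa using hδ0
  have hV : ∀ᶠ u in 𝓝 u₀, c u < c u₀ + 1 :=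
    hcc.continuousAt.eventually_lt continuousAt_const (by linarith)
  have hW : ∀ᶠ u in 𝓝 u₀, dist (∫ τ, F (x₀, τ) ∂H.meas u) (∫ τ, F (x₀, τ) ∂H.meas u₀) < ε / 2 :=
    Metric.tendsto_nhds.1 (H.continuous_integral (S x₀)).continuousAt _ (by positivity)
  filter_upwards [(hV.and hW).prod_nhds hU] with p hp
  obtain ⟨⟨hp1, hp2⟩, hp3⟩ := hp
  have hb : dist (∫ τ, F (p.2, τ) ∂H.meas p.1) (∫ τ, F (x₀, τ) ∂H.meas p.1) ≤ δ * c p.1 := by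
    rw [dist_eq_norm, ← integral_sub (hFi _ _) (hFi _ _), hc, ← integral_const_mul]
    refine norm_integral_le_of_norm_le ((hφi _).const_mul δ) (ae_of_all _ fun τ => ?_)
    by_cases hτ : τ ∈ K
    · have : φ τ = 1 := h1 hτ
      rw [this, mul_one]; exact (hp3 τ hτ).le
    · rw [hFK _ _ hτ, hFK _ _ hτ]; simp [hδ0.le, (h4 τ).1, mul_nonneg]
  have hb2 : δ * c p.1 ≤ ε / 2 := by
    calc δ * c p.1 ≤ δ * (c u₀ + 1) := by gcongr
      _ = ε / 2 := by rw [hδ]; field_simp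
  calc dist (∫ τ, F (p.2, τ) ∂H.meas p.1) (∫ τ, F (x₀, τ) ∂H.meas u₀)
      ≤ _ + _ := dist_triangle _ (∫ τ, F (x₀, τ) ∂H.meas p.1) _
    _ < ε / 2 + ε / 2 := add_lt_add_of_le_of_lt (hb.trans hb2) hp2
    _ = ε := add_halves ε

/-- Convolution `f * g (σ) = ∫ f(τ) g(τ⁻¹σ) dλ^{r(σ)}(τ)`. -/
def conv (f g : G → ℂ) (σ : G) : ℂ := ∫ τ, f τ * g (ginv τ ⋄ σ) ∂H.meas (rngU σ)

theorem continuous_div {X : Type*} [TopologicalSpace X] {a b : X → G} (ha : Continuous a)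
    (hb : Continuous b) (h : ∀ x, rng (a x) = rng (b x)) :
    Continuous fun x => ginv (a x) ⋄ b x :=
  (continuous_ginv'.comp ha).gmul hb fun x => by rw [Function.comp, src_ginv, h]

/-- The product set of the supports. -/
def prodSupp (f g : C_c(G, ℂ)) : Set G :=
  (fun p : G × G => p.1 ⋄ p.2) '' ((tsupport f ×ˢ tsupport g) ∩ {p | src p.1 = rng p.2})

theorem isCompact_prodSupp (f g : C_c(G, ℂ)) : IsCompact (prodSupp f g) :=
  isCompact_gmul f.hasCompactSupport g.hasCompactSupport

theorem mem_prodSupp {f g : C_c(G, ℂ)} {σ τ : G} (h : rng τ = rng σ) (hf : f τ ≠ 0)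
    (hg : g (ginv τ ⋄ σ) ≠ 0) : σ ∈ prodSupp f g := by
  refine ⟨(τ, ginv τ ⋄ σ), ⟨⟨subset_tsupport _ hf, subset_tsupport _ hg⟩, ?_⟩,
    gmul_ginv_cancel _ _ h⟩
  show src τ = rng (ginv τ ⋄ σ)
  rw [rng_gmul _ _ (by rw [src_ginv, h]), rng_ginv]

theorem conv_continuous (f g : C_c(G, ℂ)) : Continuous (H.conv f g) := by
  let P : Set (G × G) := {p | rng p.1 = rng p.2}
  have hP : IsClosed P :=
    isClosed_eq (continuous_rng.comp continuous_fst) (continuous_rng.comp continuous_snd)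
  let F : P → ℂ := fun p => f p.1.2 * g (ginv p.1.2 ⋄ p.1.1)
  have hF : Continuous F := by
    refine (f.continuous.comp (by fun_prop)).mul (g.continuous.comp ?_)
    exact continuous_div (by fun_prop) (by fun_prop) fun x => x.2.symm
  have hFc : HasCompactSupport F := by
    have hK : IsCompact (prodSupp f g ×ˢ tsupport f) :=
      (isCompact_prodSupp f g).prod f.hasCompactSupport
    refine HasCompactSupport.intro
      (hP.isClosedEmbedding_subtypeVal.isCompact_preimage hK) fun x hx => ?_
    by_contra h
    have h1 := left_ne_zero_of_mul h
    exact hx ⟨mem_prodSupp x.2.symm h1 (right_ne_zero_of_mul h), subset_tsupport _ h1⟩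
  obtain ⟨E, hE⟩ := exists_cc_extension hP.isClosedEmbedding_subtypeVal hF hFc
  have h1 := (H.continuous_integral_prod E).comp (continuous_rngU.prodMk continuous_id)
  refine h1.congr fun σ => ?_
  refine integral_congr_ae ?_
  filter_upwards [H.ae_fib (rngU σ)] with τ hτ using hE ⟨(σ, τ), hτ.symm⟩

theorem conv_compactSupport (f g : C_c(G, ℂ)) : HasCompactSupport (H.conv f g) := by
  refine HasCompactSupport.intro (isCompact_prodSupp f g) fun σ hσ => ?_
  refine integral_eq_zero_of_ae ?_
  filter_upwards [H.ae_fib (rngU σ)] with τ hτ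
  by_contra h
  exact hσ (mem_prodSupp hτ (left_ne_zero_of_mul h) (right_ne_zero_of_mul h))

theorem conv_integrand (f g : C_c(G, ℂ)) (σ : G) :
    Continuous (fun τ : Fib (rngU σ) => f τ * g (ginv (τ : G) ⋄ σ)) ∧
    HasCompactSupport (fun τ : Fib (rngU σ) => f τ * g (ginv (τ : G) ⋄ σ)) := by
  constructor
  · refine (f.continuous.comp (by fun_prop)).mul (g.continuous.comp ?_)
    exact continuous_div (by fun_prop) (by fun_prop) fun x => x.2
  · refine HasCompactSupport.mul_right (f := fun τ : Fib (rngU σ) => f τ) ?_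
    exact f.hasCompactSupport.comp_isClosedEmbedding
      (isClosed_fib (rngU σ)).isClosedEmbedding_subtypeVal

theorem conv_eq_fm (f g : G → ℂ) (σ : G) (u : unitSpace G) (hu : rng σ = (u : G)) :
    H.conv f g σ = ∫ τ : Fib u, f τ * g (ginv (τ : G) ⋄ σ) ∂H.fm u := by
  have : rngU σ = u := Subtype.ext hu
  subst this
  rw [H.integral_fm _ fun τ => f τ * g (ginv τ ⋄ σ)]
  rfl

theorem conv_integrable (f g : C_c(G, ℂ)) (σ : G) :
    Integrable (fun τ : Fib (rngU σ) => f τ * g (ginv (τ : G) ⋄ σ)) (H.fm (rngU σ)) :=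
  (conv_integrand f g σ).1.integrable_of_hasCompactSupport (conv_integrand f g σ).2

end HaarSystem

/-- The convolution algebra `C_c(G)` of a groupoid with Haar system: the vector space of
compactly supported continuous functions, with convolution as product and with involution
`f* (σ) = conj f(σ⁻¹)`. -/
def ConvAlg {G : Type*} [TopologicalSpace G] [T2Space G] [LocallyCompactSpace G]
    [MeasurableSpace G] [BorelSpace G] [ArrowGroupoid G] [IsTopologicalGroupoid G]
    (_H : HaarSystem G) : Type _ := C_c(G, ℂ)

namespace ConvAlg

variable {G : Type*} [TopologicalSpace G] [T2Space G] [LocallyCompactSpace G]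
    [MeasurableSpace G] [BorelSpace G] [ArrowGroupoid G] [IsTopologicalGroupoid G]
    {H : HaarSystem G}

instance : FunLike (ConvAlg H) G ℂ := inferInstanceAs (FunLike C_c(G, ℂ) G ℂ)
instance : AddCommGroup (ConvAlg H) := inferInstanceAs (AddCommGroup C_c(G, ℂ))
instance : Module ℂ (ConvAlg H) := inferInstanceAs (Module ℂ C_c(G, ℂ))

/-- The underlying compactly supported continuous function. -/
def toCc (f : ConvAlg H) : C_c(G, ℂ) := f

theorem ext {f g : ConvAlg H} (h : ∀ σ, f σ = g σ) : f = g := DFunLike.ext _ _ h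

theorem continuous (f : ConvAlg H) : Continuous f := f.toCc.continuous

theorem hasCompactSupport (f : ConvAlg H) : HasCompactSupport f := f.toCc.hasCompactSupport

theorem add_apply (f g : ConvAlg H) (σ : G) : (f + g) σ = f σ + g σ := rfl
theorem smul_apply (c : ℂ) (f : ConvAlg H) (σ : G) : (c • f) σ = c * f σ := rfl
theorem zero_apply (σ : G) : (0 : ConvAlg H) σ = 0 := rfl

instance : Mul (ConvAlg H) where
  mul f g := (⟨⟨H.conv f g, H.conv_continuous f.toCc g.toCc⟩,
    H.conv_compactSupport f.toCc g.toCc⟩ : C_c(G, ℂ))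

instance : Star (ConvAlg H) where
  star f := (⟨⟨fun σ => starRingEnd ℂ (f (ginv σ)),
      Complex.continuous_conj.comp (f.continuous.comp continuous_ginv')⟩,
    (f.hasCompactSupport.comp_homeomorph (ginvHomeo G)).comp_left
      (g := starRingEnd ℂ) (map_zero _)⟩ : C_c(G, ℂ))

theorem mul_apply (f g : ConvAlg H) (σ : G) :
    (f * g) σ = ∫ τ, f τ * g (ginv τ ⋄ σ) ∂H.meas (rngU σ) := rfl

theorem star_apply (f : ConvAlg H) (σ : G) : (star f) σ = starRingEnd ℂ (f (ginv σ)) := rfl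

theorem mul_apply_fm (f g : ConvAlg H) (σ : G) (u : unitSpace G) (hu : rng σ = (u : G)) :
    (f * g) σ = ∫ τ : Fib u, f τ * g (ginv (τ : G) ⋄ σ) ∂H.fm u :=
  H.conv_eq_fm f g σ u hu

theorem mul_apply_fm' (f g : ConvAlg H) (σ : G) :
    (f * g) σ = ∫ τ : Fib (rngU σ), f τ * g (ginv (τ : G) ⋄ σ) ∂H.fm (rngU σ) :=
  H.conv_eq_fm f g σ _ rfl

theorem mul_integrable (f g : ConvAlg H) (σ : G) :
    Integrable (fun τ : Fib (rngU σ) => f τ * g (ginv (τ : G) ⋄ σ)) (H.fm (rngU σ)) :=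
  H.conv_integrable f.toCc g.toCc σ

theorem mul_assoc' (f g h : ConvAlg H) : f * g * h = f * (g * h) := by
  refine ext fun σ => ?_
  set u := rngU σ with hu
  rw [mul_apply_fm' (f * g) h, mul_apply_fm' f (g * h)]
  have e1 : ∀ τ : Fib u, (f * g) τ * h (ginv (τ : G) ⋄ σ) =
      ∫ ρ : Fib u, f ρ * g (ginv (ρ : G) ⋄ τ) * h (ginv (τ : G) ⋄ σ) ∂H.fm u := fun τ => by
    rw [mul_apply_fm f g τ u τ.2, ← integral_mul_const]
  have e2 : ∀ ρ : Fib u, f ρ * (g * h) (ginv (ρ : G) ⋄ σ) =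
      ∫ τ : Fib u, f ρ * g (ginv (ρ : G) ⋄ τ) * h (ginv (τ : G) ⋄ σ) ∂H.fm u := fun ρ => by
    have hρ : rng (ρ : G) = rng σ := ρ.2
    have hr : rngU (ginv (ρ : G) ⋄ σ) = srcU (ρ : G) :=
      Subtype.ext ((rng_gmul _ _ (by rw [src_ginv, hρ])).trans (rng_ginv _))
    have hr2 : rngU (ρ : G) = u := Subtype.ext ρ.2
    have key := H.left_inv' (ρ : G) (fun η => g (ginv (ρ : G) ⋄ η) * h (ginv η ⋄ σ))
      (by
        refine (g.continuous.comp ?_).mul (h.continuous.comp ?_)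
        · exact HaarSystem.continuous_div continuous_const (by fun_prop) fun x => x.2.symm
        · exact HaarSystem.continuous_div (by fun_prop) continuous_const
            fun x => x.2.trans hρ)
      (by
        refine HasCompactSupport.mul_right
          (f := fun x : Fib (rngU (ρ : G)) => g (ginv (ρ : G) ⋄ x)) ?_
        have hK := isCompact_gmul (isCompact_singleton (x := (ρ : G)))
          g.hasCompactSupport.isCompact
        refine HasCompactSupport.intro
          ((isClosed_fib _).isClosedEmbedding_subtypeVal.isCompact_preimage hK) fun x hx => ?_
        by_contra h0
        have hx2 : rng (x : G) = rng (ρ : G) := x.2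
        refine hx ⟨(ρ, ginv (ρ : G) ⋄ x), ⟨⟨rfl, subset_tsupport _ h0⟩, ?_⟩,
          gmul_ginv_cancel _ _ hx2.symm⟩
        show src (ρ : G) = rng (ginv (ρ : G) ⋄ x)
        rw [rng_gmul _ _ (by rw [src_ginv, hx2]), rng_ginv])
    rw [hr2, ← H.integral_fm u] at key
    simp_rw [_root_.mul_assoc, integral_const_mul]
    rw [← key, mul_apply, hr]
    congr 1
    refine integral_congr_ae ?_
    filter_upwards [H.ae_fib (srcU (ρ : G))] with η hη
    have hη' : src (ρ : G) = rng η := hη.symm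
    have h3 : src (ginv η) = rng (ginv (ρ : G)) := by rw [src_ginv, rng_ginv, hη']
    rw [ginv_gmul_cancel _ _ hη', ginv_gmul_rev _ _ hη', gmul_assoc _ _ _ h3
      (by rw [src_ginv, hρ])]
  simp_rw [e1]
  rw [show (∫ τ : Fib (rngU σ), f τ * (g * h) (ginv (τ : G) ⋄ σ) ∂H.fm (rngU σ)) = _ from
    integral_congr_ae (ae_of_all _ e2)]
  refine integral_integral_swap_of_hasCompactSupport
    (f := fun τ ρ : Fib u => f ρ * g (ginv (ρ : G) ⋄ τ) * h (ginv (τ : G) ⋄ σ)) ?_ ?_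
  · refine ((f.continuous.comp (by fun_prop)).mul (g.continuous.comp ?_)).mul
      (h.continuous.comp ?_)
    · exact HaarSystem.continuous_div (by fun_prop) (by fun_prop) fun x => x.2.2.trans x.1.2.symm
    · exact HaarSystem.continuous_div (by fun_prop) continuous_const fun x => x.1.2
  · have hcl := (isClosed_fib u).isClosedEmbedding_subtypeVal
    have hK := (hcl.isCompact_preimage (HaarSystem.isCompact_prodSupp f.toCc g.toCc)).prod
      (hcl.isCompact_preimage f.hasCompactSupport.isCompact)
    refine HasCompactSupport.intro hK fun x hx => ?_
    by_contra h0
    have h1 := left_ne_zero_of_mul h0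
    exact hx ⟨HaarSystem.mem_prodSupp (x.2.2.trans x.1.2.symm) (left_ne_zero_of_mul h1)
      (right_ne_zero_of_mul h1), subset_tsupport _ (left_ne_zero_of_mul h1)⟩

theorem star_mul' (f g : ConvAlg H) : star (f * g) = star g * star f := by
  refine ext fun σ => ?_
  have key := H.left_inv' σ (fun η => starRingEnd ℂ (g (ginv η)) *
      starRingEnd ℂ (f (ginv σ ⋄ η)))
    (by
      refine (Complex.continuous_conj.comp (g.continuous.comp
        (continuous_ginv'.comp continuous_subtype_val))).mul
        (Complex.continuous_conj.comp (f.continuous.comp ?_))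
      exact HaarSystem.continuous_div continuous_const (by fun_prop) fun x => x.2.symm)
    (by
      refine HasCompactSupport.mul_right
        (f := fun x : Fib (rngU σ) => starRingEnd ℂ (g (ginv (x : G)))) ?_
      exact (star g).hasCompactSupport.comp_isClosedEmbedding
        (isClosed_fib (rngU σ)).isClosedEmbedding_subtypeVal)
  have hr : rngU (ginv σ) = srcU σ := Subtype.ext (rng_ginv σ)
  rw [star_apply, mul_apply, hr, ← integral_conj, mul_apply]
  have e1 : (fun τ => (star g) τ * (star f) (ginv τ ⋄ σ)) =ᵐ[H.meas (rngU σ)]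
      fun η => starRingEnd ℂ (g (ginv η)) * starRingEnd ℂ (f (ginv σ ⋄ η)) := by
    filter_upwards [H.ae_fib (rngU σ)] with τ hτ
    have hτ' : rng τ = rng σ := hτ
    rw [star_apply, star_apply, ginv_gmul_rev _ _ (by rw [src_ginv, hτ']), ginv_ginv]
  rw [integral_congr_ae e1, ← key]
  refine integral_congr_ae ?_
  filter_upwards [H.ae_fib (srcU σ)] with τ hτ
  have hτ' : src σ = rng τ := hτ.symm
  rw [map_mul, ginv_gmul_cancel _ _ hτ', ginv_gmul_rev _ _ hτ', mul_comm]

instance : NonUnitalRing (ConvAlg H) where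
  left_distrib f g h := ext fun σ => by
    rw [add_apply, mul_apply_fm', mul_apply_fm', mul_apply_fm',
      ← integral_add (mul_integrable f g σ) (mul_integrable f h σ)]
    simp_rw [add_apply, mul_add]
  right_distrib f g h := ext fun σ => by
    rw [add_apply, mul_apply_fm', mul_apply_fm', mul_apply_fm',
      ← integral_add (mul_integrable f h σ) (mul_integrable g h σ)]
    simp_rw [add_apply, add_mul]
  zero_mul f := ext fun σ => by simp [mul_apply, zero_apply]
  mul_zero f := ext fun σ => by simp [mul_apply, zero_apply]
  mul_assoc := mul_assoc'

instance : StarRing (ConvAlg H) where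
  star_involutive f := ext fun σ => by simp [star_apply, ginv_ginv]
  star_mul := star_mul'
  star_add f g := ext fun σ => by simp [star_apply, add_apply]

instance : StarModule ℂ (ConvAlg H) where
  star_smul c f := ext fun σ => by simp [star_apply, smul_apply]

instance : IsScalarTower ℂ (ConvAlg H) (ConvAlg H) where
  smul_assoc c f g := ext fun σ => by
    rw [smul_eq_mul, smul_eq_mul, smul_apply, mul_apply, mul_apply, ← integral_const_mul]
    simp_rw [smul_apply, mul_assoc]

instance : SMulCommClass ℂ (ConvAlg H) (ConvAlg H) where
  smul_comm c f g := ext fun σ => by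
    rw [smul_eq_mul, smul_eq_mul, smul_apply, mul_apply, mul_apply, ← integral_const_mul]
    simp_rw [smul_apply, mul_left_comm]

end ConvAlg

/-- A submultiplicative seminorm on a complex `*`-algebra that satisfies the `C*`-identity. -/
structure CStarSeminorm (A : Type*) [NonUnitalRing A] [StarRing A] [Module ℂ A] extends
    Seminorm ℂ A where
  mul_le' : ∀ a b, toFun (a * b) ≤ toFun a * toFun b
  star_mul_self' : ∀ a, toFun (star a * a) = toFun a * toFun a

namespace CStarSeminorm

variable {A : Type*} [NonUnitalRing A] [StarRing A] [Module ℂ A] [IsScalarTower ℂ A A]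
  [SMulCommClass ℂ A A] [StarModule ℂ A] (p : CStarSeminorm A)

/-- The algebra `A`, seminormed by `p`. -/
def Pre (_p : CStarSeminorm A) : Type _ := A

instance instNonUnitalRingPre : NonUnitalRing p.Pre := inferInstanceAs (NonUnitalRing A)

instance instSeminormedPre : NonUnitalSeminormedRing p.Pre where
  toNonUnitalRing := instNonUnitalRingPre p
  __ := AddGroupSeminorm.toSeminormedAddGroup (E := A) p.toSeminorm.toAddGroupSeminorm
  norm_mul_le := p.mul_le'

instance : StarRing p.Pre := inferInstanceAs (StarRing A)

instance instModulePre : Module ℂ p.Pre := inferInstanceAs (Module ℂ A)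

instance : NormedSpace ℂ p.Pre where
  toModule := instModulePre p
  norm_smul_le c a := (map_smul_eq_mul p.toSeminorm c (a : A)).le

instance : IsScalarTower ℂ p.Pre p.Pre := inferInstanceAs (IsScalarTower ℂ A A)
instance : SMulCommClass ℂ p.Pre p.Pre := inferInstanceAs (SMulCommClass ℂ A A)
instance : StarModule ℂ p.Pre := inferInstanceAs (StarModule ℂ A)

theorem norm_def (a : p.Pre) : ‖a‖ = p.toFun a := rfl

theorem norm_star_mul_self' (a : p.Pre) : ‖star a * a‖ = ‖a‖ * ‖a‖ := p.star_mul_self' a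

theorem norm_star_le (a : p.Pre) : ‖star a‖ ≤ ‖a‖ := by
  have h1 : ‖star a‖ * ‖star a‖ ≤ ‖a‖ * ‖star a‖ := by
    rw [← norm_star_mul_self', star_star]
    exact norm_mul_le _ _
  by_contra! h
  have h2 : 0 < ‖star a‖ := (norm_nonneg a).trans_lt h
  exact absurd (le_of_mul_le_mul_right h1 h2) (not_le.2 h)

theorem norm_star' (a : p.Pre) : ‖star a‖ = ‖a‖ :=
  le_antisymm (norm_star_le p a) (by simpa using norm_star_le p (star a))

theorem isometry_star : Isometry (star : p.Pre → p.Pre) :=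
  AddMonoidHomClass.isometry_of_norm (starAddEquiv : p.Pre ≃+ p.Pre) (norm_star' p)

open UniformSpace

/-- The Hausdorff completion of `A` with respect to `p`. -/
def Compl : Type _ := Completion p.Pre

namespace Compl

instance : NormedAddCommGroup p.Compl := inferInstanceAs (NormedAddCommGroup (Completion p.Pre))
instance : NormedSpace ℂ p.Compl := inferInstanceAs (NormedSpace ℂ (Completion p.Pre))
instance : CompleteSpace p.Compl := inferInstanceAs (CompleteSpace (Completion p.Pre))

/-- The canonical map, as an additive map. -/
def of' : p.Pre →+ p.Compl := (Completion.toCompl : p.Pre →+ Completion p.Pre)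

theorem continuous_of' : Continuous (of' p) := Completion.continuous_coe p.Pre

theorem isDenseInducing_of' : IsDenseInducing (of' p) := Completion.isDenseInducing_coe

theorem norm_of' (a : p.Pre) : ‖of' p a‖ = ‖a‖ := Completion.norm_coe a

theorem smul_of' (c : ℂ) (a : p.Pre) : of' p (c • a) = c • of' p a := Completion.coe_smul c a

instance : Star p.Compl where
  star := Completion.map (star : p.Pre → p.Pre)

theorem star_of' (a : p.Pre) : star (of' p a) = of' p (star a) :=
  Completion.map_coe (isometry_star p).uniformContinuous a

/-- Left multiplication, as a bounded bilinear map. -/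
def mulL : p.Pre →L[ℂ] p.Pre →L[ℂ] p.Pre := ContinuousLinearMap.mul ℂ p.Pre

/-- The canonical map, as a linear map. -/
def ofL : p.Pre →L[ℂ] p.Compl :=
  { toFun := of' p, map_add' := map_add (of' p), map_smul' := smul_of' p,
    cont := continuous_of' p }

theorem denseRange_ofL : DenseRange (ofL p) := (isDenseInducing_of' p).dense

theorem isUniformInducing_ofL : IsUniformInducing (ofL p) :=
  Completion.isUniformInducing_coe p.Pre

/-- The product of the completion, as a bounded bilinear map. -/
def mulC : p.Compl →L[ℂ] p.Compl →L[ℂ] p.Compl :=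
  ContinuousLinearMap.extend
    ((ContinuousLinearMap.flip (ContinuousLinearMap.extend
      (((ContinuousLinearMap.compL ℂ p.Pre p.Pre p.Compl (ofL p)).comp (mulL p)).flip)
      (ofL p)))) (ofL p)

theorem mulC_of' (a b : p.Pre) : mulC p (of' p a) (of' p b) = of' p (a * b) := by
  have h1 : mulC p (ofL p a) = _ := ContinuousLinearMap.extend_eq _ (denseRange_ofL p)
    (isUniformInducing_ofL p) a
  have h2 := ContinuousLinearMap.extend_eq
    (((ContinuousLinearMap.compL ℂ p.Pre p.Pre p.Compl (ofL p)).comp (mulL p)).flip)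
    (denseRange_ofL p) (isUniformInducing_ofL p) b
  show mulC p (ofL p a) (ofL p b) = _
  rw [h1, ContinuousLinearMap.flip_apply, h2]
  rfl

instance : Mul p.Compl where
  mul a b := mulC p a b

theorem mul_of' (a b : p.Pre) : of' p a * of' p b = of' p (a * b) := mulC_of' p a b

instance : ContinuousMul p.Compl where
  continuous_mul := (mulC p).continuous₂

theorem continuous_star : Continuous (star : p.Compl → p.Compl) :=
  Completion.continuous_map (f := (star : p.Pre → p.Pre))

instance : ContinuousStar p.Compl := ⟨continuous_star p⟩

@[elab_as_elim]
theorem induction_on {P : p.Compl → Prop} (a : p.Compl) (hp : IsClosed {a | P a})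
    (h : ∀ a, P (of' p a)) : P a :=
  Completion.induction_on (α := p.Pre) a hp h

@[elab_as_elim]
theorem induction_on₂ {P : p.Compl → p.Compl → Prop} (a b : p.Compl)
    (hp : IsClosed {q : p.Compl × p.Compl | P q.1 q.2})
    (h : ∀ a b, P (of' p a) (of' p b)) : P a b :=
  Completion.induction_on₂ (α := p.Pre) (β := p.Pre) a b hp h

@[elab_as_elim]
theorem induction_on₃ {P : p.Compl → p.Compl → p.Compl → Prop} (a b c : p.Compl)
    (hp : IsClosed {q : p.Compl × p.Compl × p.Compl | P q.1 q.2.1 q.2.2})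
    (h : ∀ a b c, P (of' p a) (of' p b) (of' p c)) : P a b c :=
  Completion.induction_on₃ (α := p.Pre) (β := p.Pre) (γ := p.Pre) a b c hp h

theorem star_smul'' (c : ℂ) (a : p.Compl) : star (c • a) = star c • star a := by
  refine induction_on p a (isClosed_eq ((continuous_star p).comp (continuous_const_smul c))
    ((continuous_const_smul (star c)).comp (continuous_star p))) fun a => ?_
  rw [← smul_of' p c a, star_of', star_of', star_smul c a, smul_of']

instance : NonUnitalNormedRing p.Compl where
  __ := (inferInstance : NormedAddCommGroup p.Compl)
  zero_mul a := induction_on p a (isClosed_eq (by fun_prop) (by fun_prop)) fun a => by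
    rw [← map_zero (of' p), mul_of', zero_mul]
  mul_zero a := induction_on p a (isClosed_eq (by fun_prop) (by fun_prop)) fun a => by
    rw [← map_zero (of' p), mul_of', mul_zero]
  mul_assoc a b c := induction_on₃ p a b c (isClosed_eq (by fun_prop) (by fun_prop))
    fun a b c => by simp_rw [mul_of', mul_assoc]
  left_distrib a b c := induction_on₃ p a b c (isClosed_eq (by fun_prop) (by fun_prop))
    fun a b c => by simp_rw [← map_add, mul_of', ← map_add, mul_add]
  right_distrib a b c := induction_on₃ p a b c (isClosed_eq (by fun_prop) (by fun_prop))
    fun a b c => by simp_rw [← map_add, mul_of', ← map_add, add_mul]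
  norm_mul_le a b := induction_on₂ p a b (isClosed_le (by fun_prop) (by fun_prop))
    fun a b => by rw [mul_of', norm_of', norm_of', norm_of']; exact norm_mul_le a b

instance : NonUnitalCStarAlgebra p.Compl where
  __ := (inferInstance : NonUnitalNormedRing p.Compl)
  __ := (inferInstance : NormedSpace ℂ p.Compl)
  star_involutive a := induction_on p a (isClosed_eq (by fun_prop) (by fun_prop)) fun a => by
    rw [star_of', star_of', star_star]
  star_mul a b := induction_on₂ p a b (isClosed_eq (by fun_prop) (by fun_prop)) fun a b => by
    rw [mul_of', star_of', star_of', star_of', mul_of', star_mul]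
  star_add a b := induction_on₂ p a b (isClosed_eq (by fun_prop) (by fun_prop)) fun a b => by
    rw [← map_add, star_of', star_of', star_of', ← map_add, star_add]
  norm_mul_self_le a := by
    refine le_of_eq (induction_on p a (isClosed_eq (by fun_prop) (by fun_prop)) fun a => ?_)
    rw [star_of', mul_of', norm_of', norm_of', norm_star_mul_self']
  toCompleteSpace := inferInstance
  smul_assoc c a b := by
    show mulC p (c • a) b = c • mulC p a b
    rw [map_smul]; rfl
  smul_comm c a b := (map_smul (mulC p a) c b).symm
  star_smul := star_smul'' p

/-- The canonical `*`-homomorphism of `A` into the completion. -/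
def of : A →⋆ₙₐ[ℂ] p.Compl where
  toFun := fun a => of' p a
  map_smul' := smul_of' p
  map_zero' := map_zero (of' p)
  map_add' := map_add (of' p)
  map_mul' a b := (mul_of' p a b).symm
  map_star' a := (star_of' p a).symm

theorem norm_of (a : A) : ‖of p a‖ = p.toSeminorm a := norm_of' p a

theorem denseRange_of : DenseRange (of p) := (isDenseInducing_of' p).dense

end Compl
end CStarSeminorm

section Schur

variable {X : Type*} [TopologicalSpace X] [T2Space X] [MeasurableSpace X]
  [OpensMeasurableSpace X] {μ : Measure X} [IsFiniteMeasureOnCompacts μ]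

theorem integrable_section {Q : X × X → ℝ} (hQ : Continuous Q) (hs : HasCompactSupport Q)
    (x : X) : Integrable (fun y => Q (x, y)) μ := by
  refine (hQ.comp (by fun_prop : Continuous fun y : X => (x, y))).integrable_of_hasCompactSupport ?_
  refine HasCompactSupport.intro (hs.isCompact.image continuous_snd) fun y hy => ?_
  by_contra h
  exact hy ⟨(x, y), subset_tsupport _ h, rfl⟩

theorem integrable_integral_section {Q : X × X → ℝ} (hQ : Continuous Q)
    (hs : HasCompactSupport Q) : Integrable (fun x => ∫ y, Q (x, y) ∂μ) μ := by
  refine Continuous.integrable_of_hasCompactSupport ?_ ?_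
  · have := continuousOn_integral_of_compact_support (μ := μ) (s := univ)
      (f := fun x y => Q (x, y)) (hs.isCompact.image continuous_snd) (by
        simpa [Function.uncurry_def] using hQ) (fun x y _ hy => by
          by_contra h
          exact hy ⟨(x, y), subset_tsupport _ h, rfl⟩)
    exact continuousOn_univ.1 this
  · refine HasCompactSupport.intro (hs.isCompact.image continuous_fst) fun x hx => ?_
    refine integral_eq_zero_of_ae (ae_of_all _ fun y => ?_)
    by_contra h
    exact hx ⟨(x, y), subset_tsupport _ h, rfl⟩

/-- The Schur test for continuous kernels. -/
theorem schur_bound {k : X → X → ℝ} {a b : X → ℝ} {C : ℝ} (hk : Continuous k.uncurry)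
    (ha : Continuous a) (hb : Continuous b) (has : HasCompactSupport a)
    (hbs : HasCompactSupport b) (hk0 : ∀ x y, 0 ≤ k x y)
    (h1 : HasCompactSupport fun p : X × X => k p.1 p.2 * a p.1 ^ 2)
    (h2 : HasCompactSupport fun p : X × X => k p.1 p.2 * b p.2 ^ 2)
    (h3 : ∀ x, ∫ y, k x y ∂μ ≤ C) (h4 : ∀ y, ∫ x, k x y ∂μ ≤ C) :
    ∫ x, ∫ y, a x * k x y * b y ∂μ ∂μ ≤ C / 2 * (∫ x, a x ^ 2 ∂μ + ∫ x, b x ^ 2 ∂μ) := by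
  have hk' : Continuous fun p : X × X => k p.1 p.2 := hk
  have c1 : Continuous fun p : X × X => k p.1 p.2 * a p.1 ^ 2 := by fun_prop
  have c2 : Continuous fun p : X × X => k p.1 p.2 * b p.2 ^ 2 := by fun_prop
  have c3 : Continuous fun p : X × X => a p.1 * k p.1 p.2 * b p.2 := by fun_prop
  have h5 : HasCompactSupport fun p : X × X => a p.1 * k p.1 p.2 * b p.2 := by
    refine HasCompactSupport.intro (has.isCompact.prod hbs.isCompact) fun p hp => ?_
    by_contra h
    exact hp ⟨subset_tsupport _ (left_ne_zero_of_mul (left_ne_zero_of_mul h)),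
      subset_tsupport _ (right_ne_zero_of_mul h)⟩
  have ia : Integrable (fun x => a x ^ 2) μ :=
    Continuous.integrable_of_hasCompactSupport (by fun_prop)
      (HasCompactSupport.intro has.isCompact fun x hx => by
        rw [image_eq_zero_of_notMem_tsupport hx]; norm_num)
  have ib : Integrable (fun x => b x ^ 2) μ :=
    Continuous.integrable_of_hasCompactSupport (by fun_prop)
      (HasCompactSupport.intro hbs.isCompact fun x hx => by
        rw [image_eq_zero_of_notMem_tsupport hx]; norm_num)
  have e1 : ∫ x, ∫ y, k x y * a x ^ 2 ∂μ ∂μ ≤ C * ∫ x, a x ^ 2 ∂μ := by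
    rw [← integral_const_mul]
    refine integral_mono (integrable_integral_section c1 h1) (ia.const_mul C) fun x => ?_
    simp only [integral_mul_const]
    exact mul_le_mul_of_nonneg_right (h3 x) (sq_nonneg _)
  have e2 : ∫ x, ∫ y, k x y * b y ^ 2 ∂μ ∂μ ≤ C * ∫ x, b x ^ 2 ∂μ := by
    rw [integral_integral_swap_of_hasCompactSupport (f := fun x y => k x y * b y ^ 2) c2 h2,
      ← integral_const_mul]
    have c2' : Continuous fun p : X × X => k p.2 p.1 * b p.1 ^ 2 := c2.comp continuous_swap
    have h2' : HasCompactSupport fun p : X × X => k p.2 p.1 * b p.1 ^ 2 :=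
      h2.comp_homeomorph (Homeomorph.prodComm X X)
    refine integral_mono (integrable_integral_section c2' h2') (ib.const_mul C) fun y => ?_
    simp only [integral_mul_const]
    exact mul_le_mul_of_nonneg_right (h4 y) (sq_nonneg _)
  calc ∫ x, ∫ y, a x * k x y * b y ∂μ ∂μ
      ≤ ∫ x, (2⁻¹ * (∫ y, k x y * a x ^ 2 ∂μ) + 2⁻¹ * (∫ y, k x y * b y ^ 2 ∂μ)) ∂μ := by
        refine integral_mono (integrable_integral_section c3 h5)
          (((integrable_integral_section c1 h1).const_mul _).add
            ((integrable_integral_section c2 h2).const_mul _)) fun x => ?_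
        have i1 := integrable_section (μ := μ) c1 h1 x
        have i2 := integrable_section (μ := μ) c2 h2 x
        simp only
        rw [← integral_const_mul, ← integral_const_mul,
          ← integral_add (i1.const_mul _) (i2.const_mul _)]
        refine integral_mono (integrable_section c3 h5 x)
          ((i1.const_mul _).add (i2.const_mul _)) fun y => ?_
        simp only
        nlinarith [mul_nonneg (hk0 x y) (sq_nonneg (a x - b y))]
    _ = 2⁻¹ * (∫ x, ∫ y, k x y * a x ^ 2 ∂μ ∂μ) + 2⁻¹ * (∫ x, ∫ y, k x y * b y ^ 2 ∂μ ∂μ) := by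
        rw [integral_add ((integrable_integral_section c1 h1).const_mul _)
          ((integrable_integral_section c2 h2).const_mul _), integral_const_mul,
          integral_const_mul]
    _ ≤ _ := by linarith

end Schur

/-- Compactly supported continuous functions are dense in `L²` of a Radon measure on a locally
compact Hausdorff space. -/
theorem exists_cc_eLpNorm_sub_le {X : Type*} [TopologicalSpace X] [T2Space X]
    [LocallyCompactSpace X] [MeasurableSpace X] [BorelSpace X] {μ : Measure X} [μ.Regular]
    {f : X → ℂ} (hf : MemLp f 2 μ) {ε : ENNReal} (hε : ε ≠ 0) :
    ∃ g : X → ℂ, eLpNorm (f - g) 2 μ ≤ ε ∧ Continuous g ∧ HasCompactSupport g := by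
  refine hf.induction_dense (P := fun g => Continuous g ∧ HasCompactSupport g) (by simp)
    ?_ ?_ ?_ hε
  · intro c t ht htμ ε hε
    obtain ⟨δ, δpos, hδ⟩ := exists_Lp_half ℂ μ 2 hε
    obtain ⟨η, ηpos, hη⟩ := exists_eLpNorm_indicator_le (μ := μ) (p := 2) (by simp) c δpos.ne'
    have hη' : (0 : ENNReal) < η := ENNReal.coe_pos.2 ηpos
    obtain ⟨s, st, s_compact, s_closed, μs⟩ :=
      ht.exists_isCompact_isClosed_sdiff_lt htμ.ne hη'.ne'
    obtain ⟨V, sV, V_open, -, hV⟩ := s_closed.measurableSet.exists_isOpen_sdiff_lt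
      ((measure_mono st).trans_lt htμ).ne hη'.ne'
    obtain ⟨φ, h1, h2, h3, h4⟩ := exists_continuous_one_zero_of_isCompact s_compact
      V_open.isClosed_compl (disjoint_compl_right_iff_subset.2 sV)
    have hgc : Continuous fun x => (φ x : ℂ) * c := by fun_prop
    have hgs : HasCompactSupport fun x => (φ x : ℂ) * c :=
      (h3.comp_left (g := fun r : ℝ => (r : ℂ)) Complex.ofReal_zero).mul_right
    have I1 : eLpNorm ((s.indicator fun _ => c) - t.indicator fun _ => c) 2 μ ≤ δ := by
      rw [← eLpNorm_neg, neg_sub, ← indicator_sdiff st]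
      exact hη _ μs.le
    have I2 : eLpNorm ((fun x => (φ x : ℂ) * c) - s.indicator fun _ => c) 2 μ ≤ δ := by
      refine (eLpNorm_mono fun x => ?_).trans (hη (V \ s) hV.le)
      by_cases hs : x ∈ s
      · have : φ x = 1 := h1 hs
        simp [hs, this]
      · by_cases hv : x ∈ V
        · have h5 := h4 x
          simp only [Pi.sub_apply, hs, not_false_eq_true, indicator_of_notMem, sub_zero, norm_mul,
            Complex.norm_real, Real.norm_eq_abs, abs_of_nonneg h5.1, Set.mem_sdiff, hv, and_self,
            indicator_of_mem]
          exact mul_le_of_le_one_left (norm_nonneg c) h5.2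
        · have : φ x = 0 := h2 hv
          simp [hs, hv, this]
    refine ⟨_, ?_, hgc, hgs⟩
    have I3 := (hδ _ _ (hgc.aestronglyMeasurable.sub
        (aestronglyMeasurable_const.indicator s_closed.measurableSet))
      ((aestronglyMeasurable_const.indicator s_closed.measurableSet).sub
        (aestronglyMeasurable_const.indicator ht)) I2 I1).le
    simpa only [sub_add_sub_cancel] using I3
  · rintro f g ⟨hf, hf'⟩ ⟨hg, hg'⟩
    exact ⟨hf.add hg, hf'.add hg'⟩
  · rintro f ⟨hf, hf'⟩
    exact (hf.memLp_of_hasCompactSupport (p := 2) hf').1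

namespace HaarSystem

variable {G : Type*} [TopologicalSpace G] [T2Space G] [LocallyCompactSpace G]
    [MeasurableSpace G] [BorelSpace G] [ArrowGroupoid G] [IsTopologicalGroupoid G]
    (H : HaarSystem G)

/-- The measure `λᵤ`, the image of `λᵘ` under inversion. -/
def measInv (u : unitSpace G) : Measure G := (H.meas u).map ginv

instance (u : unitSpace G) : (H.measInv u).Regular := Measure.Regular.map (ginvHomeo G)

theorem integral_measInv {E : Type*} [NormedAddCommGroup E] [NormedSpace ℝ E] (u : unitSpace G)
    (h : G → E) : ∫ σ, h σ ∂H.measInv u = ∫ ρ : Fib u, h (ginv (ρ : G)) ∂H.fm u := by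
  rw [H.integral_fm u fun ρ => h (ginv ρ)]
  exact (ginvHomeo G).measurableEmbedding.integral_map h

/-- The `I`-norm. -/
def iNorm (f : ConvAlg H) : ℝ :=
  max (⨆ u, ∫ σ, ‖f σ‖ ∂H.measInv u) (⨆ u, ∫ σ, ‖f σ‖ ∂H.meas u)

theorem bddAbove_norm (f : C_c(G, ℂ)) : BddAbove (range fun u => ∫ σ, ‖f σ‖ ∂H.meas u) := by
  let F : C_c(G, ℂ) := ⟨⟨fun σ => (‖f σ‖ : ℂ), by fun_prop⟩,
    f.hasCompactSupport.comp_left (g := fun z : ℂ => (‖z‖ : ℂ)) (by simp)⟩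
  have h1 : ∀ u, (∫ σ, ‖f σ‖ ∂H.meas u) = (∫ σ, F σ ∂H.meas u).re := fun u => by
    have : ∫ σ, F σ ∂H.meas u = ((∫ σ, ‖f σ‖ ∂H.meas u : ℝ) : ℂ) := integral_ofReal
    rw [this, Complex.ofReal_re]
  have hc : Continuous fun u => ∫ σ, ‖f σ‖ ∂H.meas u := by
    simp_rw [h1]; exact Complex.continuous_re.comp (H.continuous_integral F)
  have hs : HasCompactSupport fun u => ∫ σ, ‖f σ‖ ∂H.meas u := by
    refine HasCompactSupport.intro (f.hasCompactSupport.isCompact.image continuous_rngU)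
      fun u hu => integral_eq_zero_of_ae ?_
    filter_upwards [H.ae_fib u] with σ hσ
    by_contra h
    exact hu ⟨σ, subset_tsupport _ (norm_ne_zero_iff.1 h), Subtype.ext hσ⟩
  obtain ⟨C, hC⟩ := hc.bounded_above_of_compact_support hs
  exact ⟨C, by rintro _ ⟨u, rfl⟩; exact (le_abs_self _).trans (hC u)⟩

theorem integral_norm_le_iNorm (f : ConvAlg H) (u : unitSpace G) :
    ∫ σ, ‖f σ‖ ∂H.meas u ≤ H.iNorm f :=
  (le_ciSup (H.bddAbove_norm f.toCc) u).trans (le_max_right _ _)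

theorem integral_norm_star_le_iNorm (f : ConvAlg H) (u : unitSpace G) :
    ∫ σ, ‖star f σ‖ ∂H.meas u ≤ H.iNorm f := by
  have h : ∀ u, ∫ σ, ‖f σ‖ ∂H.measInv u = ∫ σ, ‖star f σ‖ ∂H.meas u := fun u => by
    rw [H.integral_measInv, H.integral_fm u fun ρ => ‖f (ginv ρ)‖]
    simp [ConvAlg.star_apply]
  rw [← h]
  refine (le_ciSup (f := fun u => ∫ σ, ‖f σ‖ ∂H.measInv u) ?_ u).trans (le_max_left _ _)
  simp_rw [h]
  exact H.bddAbove_norm (star f).toCc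

theorem iNorm_nonneg (f : ConvAlg H) : 0 ≤ H.iNorm f :=
  le_max_of_le_left (Real.iSup_nonneg fun _ => integral_nonneg fun _ => norm_nonneg _)

/-- The inclusion of `C_c(G)` into `L²(G, λᵤ)`. -/
def toL2 (u : unitSpace G) : ConvAlg H →ₗ[ℂ] Lp ℂ 2 (H.measInv u) where
  toFun f := (f.continuous.memLp_of_hasCompactSupport f.hasCompactSupport).toLp f
  map_add' _ _ := rfl
  map_smul' _ _ := rfl

theorem coeFn_toL2 (u : unitSpace G) (f : ConvAlg H) : H.toL2 u f =ᵐ[H.measInv u] f :=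
  MemLp.coeFn_toLp (f.continuous.memLp_of_hasCompactSupport f.hasCompactSupport)

theorem denseRange_toL2 (u : unitSpace G) : DenseRange (H.toL2 u) := by
  intro f
  rw [Metric.mem_closure_range_iff]
  intro ε hε
  obtain ⟨g, hg2, hg3, hg1⟩ := exists_cc_eLpNorm_sub_le (Lp.memLp f)
    (ε := ENNReal.ofReal (ε / 2)) (by simpa using hε)
  refine ⟨(⟨⟨g, hg3⟩, hg1⟩ : C_c(G, ℂ)), ?_⟩
  rw [Lp.dist_def]
  have : eLpNorm (⇑f - ⇑(H.toL2 u (⟨⟨g, hg3⟩, hg1⟩ : C_c(G, ℂ)))) 2 (H.measInv u) ≤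
      ENNReal.ofReal (ε / 2) := by
    refine le_of_eq_of_le (eLpNorm_congr_ae ?_) hg2
    exact (ae_eq_refl _).sub (H.coeFn_toL2 u (⟨⟨g, hg3⟩, hg1⟩ : C_c(G, ℂ)))
  calc _ ≤ (ENNReal.ofReal (ε / 2)).toReal := ENNReal.toReal_mono (by simp) this
    _ = ε / 2 := ENNReal.toReal_ofReal (by positivity)
    _ < ε := by linarith

theorem inner_toL2 (u : unitSpace G) (f g : ConvAlg H) :
    inner ℂ (H.toL2 u f) (H.toL2 u g) =
      ∫ ρ : Fib u, starRingEnd ℂ (f (ginv (ρ : G))) * g (ginv (ρ : G)) ∂H.fm u := by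
  rw [L2.inner_def, ← H.integral_measInv u fun σ => starRingEnd ℂ (f σ) * g σ]
  refine integral_congr_ae ?_
  filter_upwards [H.coeFn_toL2 u f, H.coeFn_toL2 u g] with σ h1 h2
  rw [h1, h2, RCLike.inner_apply, mul_comm]

theorem norm_sq_toL2 (u : unitSpace G) (f : ConvAlg H) :
    ‖H.toL2 u f‖ ^ 2 = ∫ ρ : Fib u, ‖f (ginv (ρ : G))‖ ^ 2 ∂H.fm u := by
  have h := H.inner_toL2 u f f
  rw [inner_self_eq_norm_sq_to_K] at h
  have h2 : (fun ρ : Fib u => starRingEnd ℂ (f (ginv (ρ : G))) * f (ginv (ρ : G))) =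
      fun ρ : Fib u => ((‖f (ginv (ρ : G))‖ ^ 2 : ℝ) : ℂ) := by
    ext ρ; rw [Complex.conj_mul']; push_cast; rfl
  have h3 : ∫ ρ : Fib u, ((‖f (ginv (ρ : G))‖ ^ 2 : ℝ) : ℂ) ∂H.fm u =
      ((∫ ρ : Fib u, ‖f (ginv (ρ : G))‖ ^ 2 ∂H.fm u : ℝ) : ℂ) := integral_ofReal
  rw [h2, h3] at h
  have h4 : ((‖H.toL2 u f‖ ^ 2 : ℝ) : ℂ) = _ := (Complex.ofReal_pow _ _).trans h
  exact Complex.ofReal_injective h4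

theorem fib_div_continuous (u : unitSpace G) (f : ConvAlg H) :
    Continuous fun p : Fib u × Fib u => f (ginv (p.1 : G) ⋄ p.2) :=
  f.continuous.comp (continuous_div (by fun_prop) (by fun_prop) fun x => x.1.2.trans x.2.2.symm)

theorem fib_ginv_cc (u : unitSpace G) (f : ConvAlg H) :
    Continuous (fun ρ : Fib u => f (ginv (ρ : G))) ∧
    HasCompactSupport (fun ρ : Fib u => f (ginv (ρ : G))) :=
  ⟨f.continuous.comp (continuous_ginv'.comp continuous_subtype_val),
    (f.hasCompactSupport.comp_homeomorph (ginvHomeo G)).comp_isClosedEmbedding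
      (isClosed_fib u).isClosedEmbedding_subtypeVal⟩

theorem fib_div_left_inv (u : unitSpace G) (f : G → ℂ) (hc : Continuous f)
    (hs : HasCompactSupport f) (g : G → ℂ) (hg : Continuous g) (ρ : Fib u) :
    ∫ η : Fib u, f (ginv (ρ : G) ⋄ η) * g (ginv (η : G)) ∂H.fm u =
      ∫ τ, f τ * g (ginv ((ρ : G) ⋄ τ)) ∂H.meas (srcU (ρ : G)) := by
  have hr : rngU (ρ : G) = u := Subtype.ext ρ.2
  have key := H.left_inv' (ρ : G) (fun η => f (ginv (ρ : G) ⋄ η) * g (ginv η))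
    ((hc.comp (continuous_div continuous_const (by fun_prop) fun x => x.2.symm)).mul
      (hg.comp (continuous_ginv'.comp continuous_subtype_val)))
    (by
      refine HasCompactSupport.mul_right
        (f := fun x : Fib (rngU (ρ : G)) => f (ginv (ρ : G) ⋄ x)) ?_
      have hK := isCompact_gmul (isCompact_singleton (x := (ρ : G))) hs.isCompact
      refine HasCompactSupport.intro
        ((isClosed_fib _).isClosedEmbedding_subtypeVal.isCompact_preimage hK) fun x hx => ?_
      by_contra h0
      have hx2 : rng (x : G) = rng (ρ : G) := x.2
      refine hx ⟨(ρ, ginv (ρ : G) ⋄ x), ⟨⟨rfl, subset_tsupport _ h0⟩, ?_⟩,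
        gmul_ginv_cancel _ _ hx2.symm⟩
      show src (ρ : G) = rng (ginv (ρ : G) ⋄ x)
      rw [rng_gmul _ _ (by rw [src_ginv, hx2]), rng_ginv])
  rw [hr, ← H.integral_fm u] at key
  rw [← key]
  refine integral_congr_ae ?_
  filter_upwards [H.ae_fib (srcU (ρ : G))] with τ hτ
  have hτ' : src (ρ : G) = rng τ := hτ.symm
  rw [ginv_gmul_cancel _ _ hτ']

theorem mul_apply_ginv (u : unitSpace G) (f g : ConvAlg H) (ρ : Fib u) :
    (f * g) (ginv (ρ : G)) = ∫ η : Fib u, f (ginv (ρ : G) ⋄ η) * g (ginv (η : G)) ∂H.fm u := by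
  have hr2 : rngU (ginv (ρ : G)) = srcU (ρ : G) := Subtype.ext (rng_ginv _)
  rw [H.fib_div_left_inv u f f.continuous f.hasCompactSupport g g.continuous ρ,
    ConvAlg.mul_apply, hr2]
  refine integral_congr_ae ?_
  filter_upwards [H.ae_fib (srcU (ρ : G))] with τ hτ
  have hτ' : src (ρ : G) = rng τ := hτ.symm
  rw [ginv_gmul_rev _ _ hτ']

theorem integral_norm_div (u : unitSpace G) (f : ConvAlg H) (ρ : Fib u) :
    ∫ η : Fib u, ‖f (ginv (ρ : G) ⋄ η)‖ ∂H.fm u = ∫ τ, ‖f τ‖ ∂H.meas (srcU (ρ : G)) := by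
  have h := H.fib_div_left_inv u (fun σ => (‖f σ‖ : ℂ))
    (Complex.continuous_ofReal.comp f.continuous.norm)
    (f.hasCompactSupport.comp_left (g := fun z : ℂ => (‖z‖ : ℂ)) (by simp))
    (fun _ => 1) continuous_const ρ
  simp only [mul_one] at h
  have h3 : ∫ η : Fib u, (‖f (ginv (ρ : G) ⋄ η)‖ : ℂ) ∂H.fm u =
      ((∫ η : Fib u, ‖f (ginv (ρ : G) ⋄ η)‖ ∂H.fm u : ℝ) : ℂ) := integral_ofReal
  have h4 : ∫ τ, (‖f τ‖ : ℂ) ∂H.meas (srcU (ρ : G)) =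
      ((∫ τ, ‖f τ‖ ∂H.meas (srcU (ρ : G)) : ℝ) : ℂ) := integral_ofReal
  rw [h3, h4] at h
  exact_mod_cast h

theorem star_div (u : unitSpace G) (f : ConvAlg H) (ρ η : Fib u) :
    star f (ginv (η : G) ⋄ ρ) = starRingEnd ℂ (f (ginv (ρ : G) ⋄ η)) := by
  have h : rng (η : G) = rng (ρ : G) := η.2.trans ρ.2.symm
  rw [ConvAlg.star_apply, ginv_gmul_rev _ _ (by rw [src_ginv, h]), ginv_ginv]

theorem inner_mul_toL2 (u : unitSpace G) (f g h : ConvAlg H) :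
    inner ℂ (H.toL2 u (f * g)) (H.toL2 u h) = inner ℂ (H.toL2 u g) (H.toL2 u (star f * h)) := by
  rw [H.inner_toL2, H.inner_toL2]
  have e1 : ∀ ρ : Fib u, starRingEnd ℂ ((f * g) (ginv (ρ : G))) * h (ginv (ρ : G)) =
      ∫ η : Fib u, starRingEnd ℂ (f (ginv (ρ : G) ⋄ η)) *
        (starRingEnd ℂ (g (ginv (η : G))) * h (ginv (ρ : G))) ∂H.fm u := fun ρ => by
    rw [H.mul_apply_ginv u, ← integral_conj, ← integral_mul_const]
    simp_rw [map_mul, mul_assoc]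
  have e2 : ∀ η : Fib u, starRingEnd ℂ (g (ginv (η : G))) * (star f * h) (ginv (η : G)) =
      ∫ ρ : Fib u, starRingEnd ℂ (f (ginv (ρ : G) ⋄ η)) *
        (starRingEnd ℂ (g (ginv (η : G))) * h (ginv (ρ : G))) ∂H.fm u := fun η => by
    rw [H.mul_apply_ginv u, ← integral_const_mul]
    simp_rw [H.star_div u, mul_left_comm]
  simp_rw [e1, e2]
  have hg := H.fib_ginv_cc u g
  have hh := H.fib_ginv_cc u h
  refine integral_integral_swap_of_hasCompactSupport
    (f := fun ρ η : Fib u => starRingEnd ℂ (f (ginv (ρ : G) ⋄ η)) *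
        (starRingEnd ℂ (g (ginv (η : G))) * h (ginv (ρ : G)))) ?_ ?_
  · exact (Complex.continuous_conj.comp (H.fib_div_continuous u f)).mul
      ((Complex.continuous_conj.comp (hg.1.comp continuous_snd)).mul (hh.1.comp continuous_fst))
  · refine HasCompactSupport.intro (hh.2.isCompact.prod hg.2.isCompact) fun p hp => ?_
    by_contra h0
    have h1 := right_ne_zero_of_mul h0
    refine hp ⟨subset_tsupport _ (right_ne_zero_of_mul h1), subset_tsupport _ ?_⟩
    have h2 := left_ne_zero_of_mul h1
    exact fun h3 => h2 ((congrArg (starRingEnd ℂ) h3).trans (map_zero _))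

theorem norm_inner_mul_le (u : unitSpace G) (f g h : ConvAlg H) :
    ‖inner ℂ (H.toL2 u h) (H.toL2 u (f * g))‖ ≤
      H.iNorm f / 2 * (‖H.toL2 u h‖ ^ 2 + ‖H.toL2 u g‖ ^ 2) := by
  have hg := H.fib_ginv_cc u g
  have hh := H.fib_ginv_cc u h
  have hf := H.fib_div_continuous u f
  have hcl := (isClosed_fib u).isClosedEmbedding_subtypeVal
  have hfs := f.hasCompactSupport.isCompact
  have e1 : ∀ ρ : Fib u, starRingEnd ℂ (h (ginv (ρ : G))) * (f * g) (ginv (ρ : G)) =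
      ∫ η : Fib u, starRingEnd ℂ (h (ginv (ρ : G))) *
        (f (ginv (ρ : G) ⋄ η) * g (ginv (η : G))) ∂H.fm u := fun ρ => by
    rw [H.mul_apply_ginv u, ← integral_const_mul]
  have hag : HasCompactSupport fun η : Fib u => ‖g (ginv (η : G))‖ := hg.2.norm
  have hah : HasCompactSupport fun η : Fib u => ‖h (ginv (η : G))‖ := hh.2.norm
  have key := schur_bound (μ := H.fm u) (k := fun ρ η : Fib u => ‖f (ginv (ρ : G) ⋄ η)‖)
    (a := fun ρ : Fib u => ‖h (ginv (ρ : G))‖) (b := fun ρ : Fib u => ‖g (ginv (ρ : G))‖)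
    (C := H.iNorm f) hf.norm hh.1.norm hg.1.norm hah hag (fun _ _ => norm_nonneg _) (by
      have hK := isCompact_gmul (hh.2.isCompact.image continuous_subtype_val) hfs
      refine HasCompactSupport.intro (hh.2.isCompact.prod (hcl.isCompact_preimage hK))
        fun p hp => ?_
      by_contra h0
      have h1 : h (ginv (p.1 : G)) ≠ 0 := by
        intro h2; rw [h2] at h0; simp at h0
      have h3 : f (ginv (p.1 : G) ⋄ p.2) ≠ 0 := by
        intro h2; rw [h2] at h0; simp at h0
      have hpr : rng (p.1 : G) = rng (p.2 : G) := p.1.2.trans p.2.2.symm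
      refine hp ⟨subset_tsupport _ h1, (p.1, ginv (p.1 : G) ⋄ p.2), ⟨⟨⟨p.1, subset_tsupport _ h1,
        rfl⟩, subset_tsupport _ h3⟩, ?_⟩, gmul_ginv_cancel _ _ hpr⟩
      show src (p.1 : G) = rng (ginv (p.1 : G) ⋄ p.2)
      rw [rng_gmul _ _ (by rw [src_ginv, hpr]), rng_ginv]) (by
      have hK := isCompact_gmul (hg.2.isCompact.image continuous_subtype_val)
        (star f).hasCompactSupport.isCompact
      refine HasCompactSupport.intro ((hcl.isCompact_preimage hK).prod hg.2.isCompact)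
        fun p hp => ?_
      by_contra h0
      have h1 : g (ginv (p.2 : G)) ≠ 0 := by
        intro h2; rw [h2] at h0; simp at h0
      have h3 : star f (ginv (p.2 : G) ⋄ p.1) ≠ 0 := by
        intro h2
        rw [H.star_div u, map_eq_zero] at h2
        rw [h2] at h0; simp at h0
      have hpr : rng (p.2 : G) = rng (p.1 : G) := p.2.2.trans p.1.2.symm
      refine hp ⟨⟨(p.2, ginv (p.2 : G) ⋄ p.1), ⟨⟨⟨p.2, subset_tsupport _ h1,
        rfl⟩, subset_tsupport _ h3⟩, ?_⟩, gmul_ginv_cancel _ _ hpr⟩, subset_tsupport _ h1⟩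
      show src (p.2 : G) = rng (ginv (p.2 : G) ⋄ p.1)
      rw [rng_gmul _ _ (by rw [src_ginv, hpr]), rng_ginv])
    (fun ρ => by
      rw [H.integral_norm_div u f ρ]
      exact H.integral_norm_le_iNorm f _)
    (fun η => by
      have : ∀ ρ : Fib u, ‖f (ginv (ρ : G) ⋄ η)‖ = ‖star f (ginv (η : G) ⋄ ρ)‖ := fun ρ => by
        rw [H.star_div u]; simp
      simp_rw [this]
      rw [H.integral_norm_div u (star f) η]
      exact H.integral_norm_star_le_iNorm f _)
  rw [H.inner_toL2, H.norm_sq_toL2, H.norm_sq_toL2]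
  refine le_trans ?_ key
  simp_rw [e1]
  have c3 : Continuous fun p : Fib u × Fib u =>
      ‖h (ginv (p.1 : G))‖ * ‖f (ginv (p.1 : G) ⋄ p.2)‖ * ‖g (ginv (p.2 : G))‖ :=
    ((hh.1.norm.comp continuous_fst).mul hf.norm).mul (hg.1.norm.comp continuous_snd)
  have h5 : HasCompactSupport fun p : Fib u × Fib u =>
      ‖h (ginv (p.1 : G))‖ * ‖f (ginv (p.1 : G) ⋄ p.2)‖ * ‖g (ginv (p.2 : G))‖ := by
    refine HasCompactSupport.intro (hah.isCompact.prod hag.isCompact) fun p hp => ?_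
    by_contra h
    exact hp ⟨subset_tsupport _ (left_ne_zero_of_mul (left_ne_zero_of_mul h)),
      subset_tsupport _ (right_ne_zero_of_mul h)⟩
  refine norm_integral_le_of_norm_le (integrable_integral_section c3 h5) (ae_of_all _ fun ρ => ?_)
  refine norm_integral_le_of_norm_le (integrable_section c3 h5 ρ) (ae_of_all _ fun η => ?_)
  simp [mul_assoc]

theorem norm_toL2_mul_le (u : unitSpace G) (f g : ConvAlg H) :
    ‖H.toL2 u (f * g)‖ ≤ H.iNorm f * ‖H.toL2 u g‖ := by
  set I := H.iNorm f with hI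
  have hI0 : 0 ≤ I := H.iNorm_nonneg f
  set x := ‖H.toL2 u (f * g)‖ with hx
  set y := ‖H.toL2 u g‖ with hy
  have hx0 : 0 ≤ x := norm_nonneg _
  have hy0 : 0 ≤ y := norm_nonneg _
  -- scale the two arguments
  have key : ∀ s t : ℝ, 0 ≤ s → 0 ≤ t → s * t * x ^ 2 ≤ I / 2 * (s ^ 2 * x ^ 2 + t ^ 2 * y ^ 2) := by
    intro s t hs ht
    have h := H.norm_inner_mul_le u f ((t : ℂ) • g) ((s : ℂ) • (f * g))
    rw [mul_smul_comm, map_smul, map_smul, map_smul, inner_smul_left, inner_smul_right,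
      inner_self_eq_norm_sq_to_K, norm_smul, norm_smul] at h
    simp only [norm_mul, Complex.norm_real, RCLike.norm_conj, Real.norm_eq_abs, abs_of_nonneg hs,
      abs_of_nonneg ht, norm_pow, RCLike.norm_ofReal, abs_of_nonneg (norm_nonneg _)] at h
    rw [mul_pow, mul_pow] at h
    rw [← hx, ← hy] at h
    linarith
  rcases hx0.eq_or_lt with h0 | h0
  · rw [← h0]; positivity
  have h1 := key (y + 1) 0 (by positivity) le_rfl
  have hI1 : ∀ δ > 0, x ≤ I * (y + δ) := by
    intro δ hδ
    have h2 := key (y + δ) x (by positivity) hx0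
    have h3 : x ^ 2 * y ^ 2 ≤ x ^ 2 * (y + δ) ^ 2 := by gcongr; linarith
    have h4 : (y + δ) * x * x ^ 2 ≤ I / 2 * ((y + δ) ^ 2 * x ^ 2 + x ^ 2 * (y + δ) ^ 2) :=
      h2.trans (by gcongr)
    have h5 : 0 < (y + δ) * x ^ 2 := by positivity
    have h6 : x * ((y + δ) * x ^ 2) ≤ I * (y + δ) * ((y + δ) * x ^ 2) := by nlinarith
    exact le_of_mul_le_mul_right h6 h5
  refine le_of_forall_pos_le_add fun ε hε => ?_
  have h2 := hI1 (ε / (I + 1)) (by positivity)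
  have h3 : I * (ε / (I + 1)) ≤ ε := by
    rw [mul_div_assoc', div_le_iff₀ (by positivity)]
    nlinarith
  linarith

/-- The regular representation `Ind δᵤ` of `C_c(G)` on `L²(G, λᵤ)`, as bounded operators: the
continuous extension of `g ↦ f * g`. -/
def indOp (u : unitSpace G) (f : ConvAlg H) :
    Lp ℂ 2 (H.measInv u) →L[ℂ] Lp ℂ 2 (H.measInv u) :=
  ((H.toL2 u).comp (LinearMap.mulLeft ℂ f)).extendOfNorm (H.toL2 u)

theorem indOp_toL2 (u : unitSpace G) (f g : ConvAlg H) :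
    H.indOp u f (H.toL2 u g) = H.toL2 u (f * g) :=
  LinearMap.extendOfNorm_eq (H.denseRange_toL2 u) ⟨H.iNorm f, fun g => H.norm_toL2_mul_le u f g⟩ g

theorem norm_indOp_le (u : unitSpace G) (f : ConvAlg H) : ‖H.indOp u f‖ ≤ H.iNorm f :=
  LinearMap.opNorm_extendOfNorm_le (H.denseRange_toL2 u) (H.iNorm_nonneg f)
    fun g => H.norm_toL2_mul_le u f g

theorem op_ext (u : unitSpace G) {A B : Lp ℂ 2 (H.measInv u) →L[ℂ] Lp ℂ 2 (H.measInv u)}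
    (h : ∀ g, A (H.toL2 u g) = B (H.toL2 u g)) : A = B :=
  ContinuousLinearMap.coeFn_injective
    ((H.denseRange_toL2 u).equalizer A.continuous B.continuous (funext h))

/-- The regular representation `Ind δᵤ` as a `*`-homomorphism. -/
def ind (u : unitSpace G) :
    ConvAlg H →⋆ₙₐ[ℂ] (Lp ℂ 2 (H.measInv u) →L[ℂ] Lp ℂ 2 (H.measInv u)) where
  toFun := H.indOp u
  map_smul' c f := H.op_ext u fun g => by
    simp [indOp_toL2, smul_mul_assoc]
  map_zero' := H.op_ext u fun g => by simp [indOp_toL2]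
  map_add' f₁ f₂ := H.op_ext u fun g => by simp [indOp_toL2, add_mul]
  map_mul' f₁ f₂ := H.op_ext u fun g => by
    rw [mul_apply_eq_comp, indOp_toL2, indOp_toL2, indOp_toL2, mul_assoc]
  map_star' f := by
    rw [ContinuousLinearMap.star_eq_adjoint, ContinuousLinearMap.eq_adjoint_iff]
    intro x y
    refine (H.denseRange_toL2 u).induction_on₂
      (p := fun x y => inner ℂ (H.indOp u (star f) x) y = inner ℂ x (H.indOp u f y))
      (isClosed_eq (by fun_prop) (by fun_prop)) (fun g h => ?_) x y
    rw [indOp_toL2, indOp_toL2, inner_mul_toL2, star_star]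

end HaarSystem

/-- The trivial group bundle `G⁽⁰⁾ × Γ` as a groupoid: `(u, α)` and `(v, β)` are composable if and
only if `u = v`, with product `(u, α β)`. -/
instance trivialBundle (G Γ : Type*) [ArrowGroupoid G] [Group Γ] :
    ArrowGroupoid (unitSpace G × Γ) where
  src p := (p.1, 1)
  rng p := (p.1, 1)
  gmul p q := (p.1, p.2 * q.2)
  ginv p := (p.1, p.2⁻¹)
  src_src _ := rfl
  rng_src _ := rfl
  src_rng _ := rfl
  rng_rng _ := rfl
  src_gmul _ _ h := Prod.ext (congrArg Prod.fst h) rfl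
  rng_gmul _ _ _ := rfl
  gmul_assoc _ _ _ _ _ := Prod.ext rfl (mul_assoc _ _ _)
  gmul_src _ := Prod.ext rfl (mul_one _)
  rng_gmul_self _ := Prod.ext rfl (one_mul _)
  src_ginv _ := rfl
  rng_ginv _ := rfl
  ginv_gmul _ := Prod.ext rfl (inv_mul_cancel _)
  gmul_ginv _ := Prod.ext rfl (mul_inv_cancel _)

/-- A `Γ`-twist `G⁽⁰⁾ × Γ → S → G` over the groupoid `G`. By `units_eq` and `proj_incl_one` the maps
`u ↦ ι(u, e)` and `π` restrict to mutually inverse homeomorphisms between the unit spaces of `G` and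
of `S`, and these are the identification of the unit spaces; so `r(σ)`, regarded as a unit of `G`,
is `r(π(σ))`. -/
structure Twist (Γ G S : Type*) [CommGroup Γ] [TopologicalSpace Γ]
    [TopologicalSpace G] [ArrowGroupoid G] [TopologicalSpace S] [ArrowGroupoid S] where
  incl : unitSpace G × Γ → S
  proj : S → G
  incl_hom : IsGroupoidHom incl
  proj_hom : IsGroupoidHom proj
  incl_isEmbedding : IsEmbedding incl
  proj_isQuotientMap : IsQuotientMap proj
  units_eq : unitSpace S = range fun u => incl (u, 1)
  proj_incl_one : ∀ u, proj (incl (u, 1)) = u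
  exact_seq : range incl = proj ⁻¹' unitSpace G
  central : ∀ (σ : S) (α : Γ),
    incl (rngU (proj σ), α) ⋄ σ = σ ⋄ incl (srcU (proj σ), α)

/-- The normalised Haar measure of a compact group. -/
def normHaar (Γ : Type*) [CommGroup Γ] [TopologicalSpace Γ] [IsTopologicalGroup Γ]
    [CompactSpace Γ] [MeasurableSpace Γ] [BorelSpace Γ] : Measure Γ :=
  Measure.haarMeasure (⊤ : TopologicalSpace.PositiveCompacts Γ)

namespace Twist

section Algebra

variable {Γ G S : Type*} [CommGroup Γ] [TopologicalSpace Γ]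
    [TopologicalSpace G] [ArrowGroupoid G] [TopologicalSpace S] [ArrowGroupoid S]
    (T : Twist Γ G S)

/-- The action of `Γ` on `S`: `α · σ = ι(r(σ), α) σ`. -/
def act (α : Γ) (σ : S) : S := T.incl (rngU (T.proj σ), α) ⋄ σ

theorem src_incl (u : unitSpace G) (α : Γ) : src (T.incl (u, α)) = T.incl (u, 1) :=
  src_hom T.incl_hom (u, α)

theorem rng_incl (u : unitSpace G) (α : Γ) : rng (T.incl (u, α)) = T.incl (u, 1) :=
  rng_hom T.incl_hom (u, α)

theorem rng_eq (σ : S) : rng σ = T.incl (rngU (T.proj σ), 1) := by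
  have h : rng σ ∈ unitSpace S := src_rng σ
  rw [T.units_eq] at h
  obtain ⟨u, hu⟩ := h
  have h2 : u = rngU (T.proj σ) := Subtype.ext <| by
    rw [← T.proj_incl_one u]
    exact (congrArg T.proj hu).trans (rng_hom T.proj_hom σ).symm
  rw [← hu, h2]

theorem src_eq (σ : S) : src σ = T.incl (srcU (T.proj σ), 1) := by
  have h := T.rng_eq (src σ)
  rw [rng_src] at h
  have h2 : rngU (T.proj (src σ)) = srcU (T.proj σ) := Subtype.ext <| by
    show rng (T.proj (src σ)) = src (T.proj σ)
    rw [rng_hom T.proj_hom, rng_src, src_hom T.proj_hom]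
  rw [h, h2]

theorem proj_incl (u : unitSpace G) (α : Γ) : T.proj (T.incl (u, α)) = u := by
  have h : T.incl (u, α) ∈ T.proj ⁻¹' unitSpace G := T.exact_seq ▸ mem_range_self _
  have h2 : src (T.proj (T.incl (u, α))) = T.proj (T.incl (u, α)) := h
  rw [← h2, src_hom T.proj_hom, src_incl, T.proj_incl_one]

theorem composable (α : Γ) (σ : S) : src (T.incl (rngU (T.proj σ), α)) = rng σ := by
  rw [src_incl, ← rng_eq]

theorem composable' (α : Γ) (σ : S) : src σ = rng (T.incl (srcU (T.proj σ), α)) := by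
  rw [rng_incl, ← src_eq]

theorem rng_act (α : Γ) (σ : S) : rng (T.act α σ) = rng σ := by
  rw [act, rng_gmul _ _ (T.composable α σ), rng_incl, ← rng_eq]

theorem src_act (α : Γ) (σ : S) : src (T.act α σ) = src σ := by
  rw [act, src_gmul _ _ (T.composable α σ)]

theorem proj_act (α : Γ) (σ : S) : T.proj (T.act α σ) = T.proj σ := by
  rw [act, (T.proj_hom _ _ (T.composable α σ)).2, proj_incl]
  exact rng_gmul_self _

theorem incl_mul (u : unitSpace G) (α β : Γ) :
    T.incl (u, α) ⋄ T.incl (u, β) = T.incl (u, α * β) :=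
  ((T.incl_hom (u, α) (u, β) rfl).2).symm

theorem act_act (α β : Γ) (σ : S) : T.act α (T.act β σ) = T.act (α * β) σ := by
  have h := T.composable β σ
  conv_lhs => rw [act, proj_act]
  rw [act, act, ← gmul_assoc _ _ _ (by rw [src_incl, rng_incl]) h, incl_mul]

theorem act_one (σ : S) : T.act 1 σ = σ := by
  rw [act, ← rng_eq, rng_gmul_self]

theorem ginv_incl (u : unitSpace G) (α : Γ) : ginv (T.incl (u, α)) = T.incl (u, α⁻¹) :=
  (eq_ginv_of_gmul _ _ (by rw [src_incl, rng_incl]) (by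
    rw [incl_mul, mul_inv_cancel, rng_incl])).symm

theorem proj_ginv (σ : S) : T.proj (ginv σ) = ginv (T.proj σ) := by
  obtain ⟨h1, h2⟩ := T.proj_hom σ (ginv σ) (rng_ginv σ).symm
  refine eq_ginv_of_gmul _ _ h1 ?_
  rw [← h2, gmul_ginv, rng_hom T.proj_hom]

theorem ginv_act (α : Γ) (σ : S) : ginv (T.act α σ) = T.act α⁻¹ (ginv σ) := by
  have h : srcU (T.proj (ginv σ)) = rngU (T.proj σ) := Subtype.ext <| by
    show src (T.proj (ginv σ)) = rng (T.proj σ)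
    rw [proj_ginv, src_ginv]
  rw [act, ginv_gmul_rev _ _ (T.composable α σ), ginv_incl, act, T.central, h]

theorem gmul_act (α : Γ) (τ σ : S) (h : src τ = rng σ) : τ ⋄ T.act α σ = T.act α (τ ⋄ σ) := by
  have h1 : srcU (T.proj (τ ⋄ σ)) = srcU (T.proj σ) := Subtype.ext <| by
    show src (T.proj (τ ⋄ σ)) = src (T.proj σ)
    rw [src_hom T.proj_hom, src_gmul _ _ h, src_hom T.proj_hom]
  rw [act, act, T.central, T.central, h1, gmul_assoc _ _ _ h (T.composable' α σ)]

theorem exists_act (σ τ : S) (h : T.proj σ = T.proj τ) : ∃ α, T.act α σ = τ := by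
  have hs : src σ = src τ := by rw [T.src_eq, T.src_eq, h]
  have hc : src τ = rng (ginv σ) := by rw [rng_ginv, hs]
  have h1 : τ ⋄ ginv σ ∈ T.proj ⁻¹' unitSpace G := by
    show src (T.proj (τ ⋄ ginv σ)) = T.proj (τ ⋄ ginv σ)
    rw [(T.proj_hom _ _ hc).2, proj_ginv, h, gmul_ginv, src_rng]
  rw [← T.exact_seq] at h1
  obtain ⟨⟨u, α⟩, hu⟩ := h1
  have hu2 : u = rngU (T.proj σ) := Subtype.ext <| by
    rw [← T.proj_incl u α, hu, (T.proj_hom _ _ hc).2, proj_ginv, h, gmul_ginv]; rfl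
  refine ⟨α, ?_⟩
  rw [act, ← hu2, hu, gmul_assoc _ _ _ hc (src_ginv σ), ginv_gmul, hs, gmul_src]

/-- A (not necessarily continuous) section of `π`. -/
def sec : G → S := Function.surjInv T.proj_isQuotientMap.surjective

theorem proj_sec (γ : G) : T.proj (T.sec γ) = γ := Function.surjInv_eq _ γ

theorem continuous_proj : Continuous T.proj := T.proj_isQuotientMap.continuous

theorem continuous_act [IsTopologicalGroupoid G] [IsTopologicalGroupoid S] :
    Continuous fun p : Γ × S => T.act p.1 p.2 := by
  refine Continuous.gmul ?_ continuous_snd fun p => T.composable _ _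
  exact T.incl_isEmbedding.continuous.comp
    ((continuous_rngU.comp (T.continuous_proj.comp continuous_snd)).prodMk continuous_fst)

end Algebra

section Haar

variable {Γ G S : Type*} [CommGroup Γ] [TopologicalSpace Γ] [IsTopologicalGroup Γ]
    [CompactSpace Γ] [T2Space Γ] [MeasurableSpace Γ] [BorelSpace Γ]
    [TopologicalSpace G] [T2Space G] [LocallyCompactSpace G]
    [MeasurableSpace G] [BorelSpace G] [ArrowGroupoid G] [IsTopologicalGroupoid G]
    [TopologicalSpace S] [T2Space S] [LocallyCompactSpace S]
    [MeasurableSpace S] [BorelSpace S] [ArrowGroupoid S] [IsTopologicalGroupoid S]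
    (T : Twist Γ G S) (lam : HaarSystem G)

instance : (normHaar Γ).IsHaarMeasure := by unfold normHaar; infer_instance

/-- The function `γ ↦ ∫_Γ f(α · 𝔰(γ)) dλ(α)`, where `𝔰` is a section of `π`. -/
def avg {E : Type*} [NormedAddCommGroup E] [NormedSpace ℝ E] (f : S → E) (γ : G) : E :=
  ∫ α, f (T.act α (T.sec γ)) ∂normHaar Γ

theorem avg_proj {E : Type*} [NormedAddCommGroup E] [NormedSpace ℝ E] (f : S → E) (σ : S) :
    T.avg f (T.proj σ) = ∫ α, f (T.act α σ) ∂normHaar Γ := by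
  obtain ⟨β, hβ⟩ := T.exists_act σ (T.sec (T.proj σ)) (T.proj_sec _).symm
  rw [avg, ← hβ]
  simp_rw [act_act]
  exact integral_mul_right_eq_self (fun α => f (T.act α σ)) β

theorem integrable_act {E : Type*} [NormedAddCommGroup E] {f : S → E} (hf : Continuous f)
    (σ : S) : Integrable (fun α => f (T.act α σ)) (normHaar Γ) :=
  (hf.comp (T.continuous_act.comp (by fun_prop : Continuous fun α : Γ => (α, σ)))
    ).integrable_of_hasCompactSupport (HasCompactSupport.of_compactSpace _)

theorem avg_continuous {E : Type*} [NormedAddCommGroup E] [NormedSpace ℝ E] {f : S → E}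
    (hf : Continuous f) : Continuous (T.avg f) := by
  rw [T.proj_isQuotientMap.continuous_iff]
  have h : T.avg f ∘ T.proj = fun σ => ∫ α, f (T.act α σ) ∂normHaar Γ := funext (T.avg_proj f)
  rw [h]
  refine continuousOn_univ.1 (continuousOn_integral_of_compact_support (k := univ) isCompact_univ
    ?_ (fun _ _ _ h => absurd (mem_univ _) h))
  exact (hf.comp (T.continuous_act.comp continuous_swap)).continuousOn

theorem avg_eq_zero {E : Type*} [NormedAddCommGroup E] [NormedSpace ℝ E] {f : S → E} {γ : G}
    (h : ∀ σ, T.proj σ = γ → f σ = 0) : T.avg f γ = 0 :=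
  integral_eq_zero_of_ae (ae_of_all _ fun α => h _ (by rw [proj_act, proj_sec]))

theorem avg_hasCompactSupport {E : Type*} [NormedAddCommGroup E] [NormedSpace ℝ E] {f : S → E}
    (hf : HasCompactSupport f) : HasCompactSupport (T.avg f) := by
  refine HasCompactSupport.intro (hf.isCompact.image T.continuous_proj) fun γ hγ => ?_
  refine T.avg_eq_zero fun σ hσ => ?_
  by_contra h
  exact hγ ⟨σ, subset_tsupport _ h, hσ⟩

theorem integrable_avg {E : Type*} [NormedAddCommGroup E] [NormedSpace ℝ E] {f : S → E}
    (hf : Continuous f) (hs : HasCompactSupport f) (u : unitSpace G) :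
    Integrable (T.avg f) (lam.meas u) :=
  (T.avg_continuous hf).integrable_of_hasCompactSupport (T.avg_hasCompactSupport hs)

/-- The positive functional `f ↦ ∫_{Gᵘ} ∫_Γ f(α · 𝔰(γ)) dλ(α) dλᵘ(γ)` on `C_c(S)`. -/
def functional (u : unitSpace G) : C_c(S, ℝ) →ₚ[ℝ] ℝ :=
  PositiveLinearMap.mk₀
    { toFun := fun f => ∫ γ, T.avg f γ ∂lam.meas u
      map_add' := fun f g => by
        have h1 : Integrable (T.avg ⇑f) (lam.meas u) :=
          T.integrable_avg lam f.continuous f.hasCompactSupport u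
        have h2 : Integrable (T.avg ⇑g) (lam.meas u) :=
          T.integrable_avg lam g.continuous g.hasCompactSupport u
        rw [← integral_add h1 h2]
        congr 1
        ext γ
        exact integral_add (T.integrable_act f.continuous _) (T.integrable_act g.continuous _)
      map_smul' := fun c f => by
        rw [RingHom.id_apply, smul_eq_mul, ← integral_const_mul]
        congr 1
        ext γ
        exact integral_const_mul c _ }
    (fun f hf => integral_nonneg fun γ => integral_nonneg fun α => hf _)

/-- The Radon measure `μᵘ` on `S` with
`∫ f dμᵘ = ∫_{Gᵘ} ∫_Γ f(α · 𝔰(γ)) dλ(α) dλᵘ(γ)` for `f ∈ C_c(S)`. -/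
def inducedMeas (u : unitSpace S) : Measure S :=
  RealRMK.rieszMeasure (T.functional lam (rngU (T.proj u)))

instance (u : unitSpace S) : (T.inducedMeas lam u).Regular := by
  unfold inducedMeas; infer_instance

theorem integral_inducedMeas_real (u : unitSpace S) (f : C_c(S, ℝ)) :
    ∫ σ, f σ ∂T.inducedMeas lam u = ∫ γ, T.avg f γ ∂lam.meas (rngU (T.proj u)) :=
  RealRMK.integral_rieszMeasure _ f

theorem integral_inducedMeas (u : unitSpace S) (f : C_c(S, ℂ)) :
    ∫ σ, f σ ∂T.inducedMeas lam u = ∫ γ, T.avg f γ ∂lam.meas (rngU (T.proj u)) := by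
  let fr : C_c(S, ℝ) := ⟨⟨fun σ => (f σ).re, Complex.continuous_re.comp f.continuous⟩,
    f.hasCompactSupport.comp_left (g := Complex.re) Complex.zero_re⟩
  let fi : C_c(S, ℝ) := ⟨⟨fun σ => (f σ).im, Complex.continuous_im.comp f.continuous⟩,
    f.hasCompactSupport.comp_left (g := Complex.im) Complex.zero_im⟩
  have h1 : Integrable f (T.inducedMeas lam u) :=
    f.continuous.integrable_of_hasCompactSupport f.hasCompactSupport
  have h2 : Integrable (T.avg ⇑f) (lam.meas (rngU (T.proj u))) :=
    T.integrable_avg lam f.continuous f.hasCompactSupport (rngU (T.proj u))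
  have hr := T.integral_inducedMeas_real lam u fr
  have hi := T.integral_inducedMeas_real lam u fi
  rw [← integral_re_add_im h1, ← integral_re_add_im h2]
  have er : ∀ γ, T.avg fr γ = RCLike.re (T.avg f γ) := fun γ =>
    integral_re (T.integrable_act f.continuous (T.sec γ))
  have ei : ∀ γ, T.avg fi γ = RCLike.im (T.avg f γ) := fun γ =>
    integral_im (T.integrable_act f.continuous (T.sec γ))
  simp_rw [er] at hr
  simp_rw [ei] at hi
  rw [← hr, ← hi]
  rfl

theorem rng_eq_iff (σ : S) (u : unitSpace S) :
    rng σ = (u : S) ↔ rng (T.proj σ) = (rngU (T.proj u) : G) := by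
  constructor
  · intro h
    show rng (T.proj σ) = rng (T.proj u)
    rw [rng_hom T.proj_hom, rng_hom T.proj_hom, h, rng_unit]
  · intro h
    have h2 : rngU (T.proj σ) = rngU (T.proj u) := Subtype.ext h
    rw [T.rng_eq, h2, ← T.rng_eq, rng_unit]

theorem support_inducedMeas (u : unitSpace S) :
    (T.inducedMeas lam u).support = {σ | rng σ = (u : S)} := by
  ext σ
  constructor
  · intro hσ
    by_contra hne
    obtain ⟨K, hK, hσK, hKU⟩ := exists_compact_subset (isClosed_fib u).isOpen_compl hne
    obtain ⟨φ, h1, h2, h3, h4⟩ := exists_continuous_one_zero_of_isCompact hK (isClosed_fib u)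
      (disjoint_left.2 fun x hx => hKU hx)
    let f : C_c(S, ℝ) := ⟨φ, h3⟩
    have hle : T.inducedMeas lam u K ≤
        ENNReal.ofReal (T.functional lam (rngU (T.proj u)) f) :=
      RealRMK.rieszMeasure_le_of_eq_one _ (f := f) (fun x => (h4 x).1) hK fun x hx => h1 hx
    have hz : T.functional lam (rngU (T.proj u)) f = 0 := by
      show ∫ γ, T.avg f γ ∂lam.meas (rngU (T.proj u)) = 0
      refine integral_eq_zero_of_ae ?_
      filter_upwards [lam.ae_fib (rngU (T.proj u))] with γ hγ
      refine T.avg_eq_zero fun τ hτ => h2 ?_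
      exact (T.rng_eq_iff τ u).2 (hτ ▸ hγ)
    rw [hz, ENNReal.ofReal_zero] at hle
    exact Measure.notMem_support_iff_exists.2
      ⟨K, mem_interior_iff_mem_nhds.1 hσK, le_antisymm hle bot_le⟩ hσ
  · intro hσ
    by_contra hns
    obtain ⟨V, hV, hV0⟩ := Measure.notMem_support_iff_exists.1 hns
    obtain ⟨W, hWV, hW, hσW⟩ := mem_nhds_iff.1 hV
    obtain ⟨φ, h1, h2, h3, h4⟩ := exists_continuous_one_zero_of_isCompact
      (isCompact_singleton (x := σ)) hW.isClosed_compl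
      (disjoint_singleton_left.2 fun h => h hσW)
    let f : C_c(S, ℝ) := ⟨φ, h3⟩
    have hf0 : ∫ τ, f τ ∂T.inducedMeas lam u = 0 := by
      refine integral_eq_zero_of_ae ?_
      have : Wᶜ ∈ ae (T.inducedMeas lam u) := by
        rw [mem_ae_iff, compl_compl]
        exact measure_mono_null hWV hV0
      filter_upwards [this] with τ hτ using h2 hτ
    rw [T.integral_inducedMeas_real lam] at hf0
    have hc : Continuous (T.avg ⇑f) := T.avg_continuous f.continuous
    have hnn : 0 ≤ T.avg ⇑f := fun γ => integral_nonneg fun α => (h4 _).1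
    have hpos : 0 < T.avg ⇑f (T.proj σ) := by
      rw [T.avg_proj]
      refine integral_pos_of_integrable_nonneg_nonzero (x := 1) ?_ (T.integrable_act φ.continuous σ)
        (fun α => (h4 _).1) ?_
      · exact φ.continuous.comp
          (T.continuous_act.comp (by fun_prop : Continuous fun α : Γ => (α, σ)))
      · show φ (T.act 1 σ) ≠ 0
        rw [T.act_one, h1 rfl]
        exact one_ne_zero
    have hmem : T.proj σ ∈ (lam.meas (rngU (T.proj u))).support := by
      rw [lam.support_eq]
      exact (T.rng_eq_iff σ u).1 hσ
    have hU : {γ | 0 < T.avg ⇑f γ} ∈ 𝓝 (T.proj σ) :=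
      (isOpen_lt continuous_const hc).mem_nhds hpos
    have hint : 0 < ∫ γ, T.avg ⇑f γ ∂lam.meas (rngU (T.proj u)) := by
      refine (integral_pos_iff_support_of_nonneg hnn
        (T.integrable_avg lam f.continuous f.hasCompactSupport _)).2 ?_
      refine ((Measure.mem_support_iff_forall _).1 hmem _ hU).trans_le (measure_mono ?_)
      intro γ hγ
      exact ne_of_gt hγ
    exact hint.ne' hf0

theorem ae_inducedMeas (u : unitSpace S) : ∀ᵐ σ ∂T.inducedMeas lam u, rng σ = (u : S) := by
  have h := Measure.support_mem_ae_of_regular (μ := T.inducedMeas lam u)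
  rw [T.support_inducedMeas lam] at h
  exact h

theorem left_inv_inducedMeas (σ : S) (f : C_c(S, ℂ)) :
    ∫ τ, f (σ ⋄ τ) ∂T.inducedMeas lam (srcU σ) = ∫ τ, f τ ∂T.inducedMeas lam (rngU σ) := by
  have hcont : Continuous fun τ : Fib (srcU σ) => f (σ ⋄ τ) :=
    f.continuous.comp (continuous_const.gmul continuous_subtype_val fun τ => τ.2.symm)
  have hcs : HasCompactSupport fun τ : Fib (srcU σ) => f (σ ⋄ τ) := by
    have hK := isCompact_gmul (isCompact_singleton (x := ginv σ)) f.hasCompactSupport.isCompact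
    refine HasCompactSupport.intro
      ((isClosed_fib _).isClosedEmbedding_subtypeVal.isCompact_preimage hK) fun τ hτ => ?_
    by_contra h0
    have hτ2 : src σ = rng (τ : S) := τ.2.symm
    refine hτ ⟨(ginv σ, σ ⋄ τ), ⟨⟨rfl, subset_tsupport _ h0⟩, ?_⟩, ginv_gmul_cancel _ _ hτ2⟩
    show src (ginv σ) = rng (σ ⋄ τ)
    rw [src_ginv, rng_gmul _ _ hτ2]
  obtain ⟨F, hF⟩ := exists_cc_extension (isClosed_fib (srcU σ)).isClosedEmbedding_subtypeVal
    hcont hcs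
  have hF' : ∀ τ, src σ = rng τ → F τ = f (σ ⋄ τ) := fun τ hτ => hF ⟨τ, hτ.symm⟩
  have e1 : ∫ τ, f (σ ⋄ τ) ∂T.inducedMeas lam (srcU σ) = ∫ τ, F τ ∂T.inducedMeas lam (srcU σ) := by
    refine integral_congr_ae ?_
    filter_upwards [T.ae_inducedMeas lam (srcU σ)] with τ hτ using (hF' τ hτ.symm).symm
  have hs : rngU (T.proj (srcU σ : S)) = srcU (T.proj σ) := Subtype.ext <| by
    show rng (T.proj (src σ)) = src (T.proj σ)
    rw [rng_hom T.proj_hom, rng_src, src_hom T.proj_hom]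
  have hr : rngU (T.proj (rngU σ : S)) = rngU (T.proj σ) := Subtype.ext <| by
    show rng (T.proj (rng σ)) = rng (T.proj σ)
    rw [rng_hom T.proj_hom, rng_hom T.proj_hom, rng_rng]
  let A : C_c(G, ℂ) := ⟨⟨T.avg ⇑f, T.avg_continuous f.continuous⟩,
    T.avg_hasCompactSupport f.hasCompactSupport⟩
  have key := lam.left_inv (T.proj σ) A
  rw [e1, T.integral_inducedMeas lam, T.integral_inducedMeas lam, hs, hr]
  refine Eq.trans (integral_congr_ae ?_) key
  filter_upwards [lam.ae_fib (srcU (T.proj σ))] with γ hγ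
  have hγ' : src (T.proj σ) = rng γ := hγ.symm
  have hc : src σ = rng (T.sec γ) := by
    rw [T.src_eq, T.rng_eq, T.proj_sec]
    congr 2
    exact Subtype.ext hγ'
  show T.avg ⇑F γ = T.avg ⇑f (T.proj σ ⋄ γ)
  have h2 : T.proj σ ⋄ γ = T.proj (σ ⋄ T.sec γ) := by
    rw [(T.proj_hom _ _ hc).2, T.proj_sec]
  rw [h2, T.avg_proj, avg]
  congr 1
  ext α
  rw [hF' _ (by rw [T.rng_act, hc]), T.gmul_act _ _ _ hc]

/-- The Haar system `μ` on `S` induced by the Haar system `lam` on `G` and the normalised Haar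
measure of `Γ`. -/
def haar : HaarSystem S where
  meas u := T.inducedMeas lam u
  regular _ := inferInstance
  support_eq u := T.support_inducedMeas lam u
  continuous_integral f := by
    simp_rw [T.integral_inducedMeas lam]
    let A : C_c(G, ℂ) := ⟨⟨T.avg ⇑f, T.avg_continuous f.continuous⟩,
      T.avg_hasCompactSupport f.hasCompactSupport⟩
    exact (lam.continuous_integral A).comp
      (continuous_rngU.comp (T.continuous_proj.comp continuous_subtype_val))
  left_inv σ f := T.left_inv_inducedMeas lam σ f

/-- The `*`-algebra `C_c(S; G; χ)` of those `f ∈ C_c(S)` with `f(α · σ) = χ(α) f(σ)`. -/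
def Cc (χ : Γ →ₜ* Circle) : NonUnitalStarSubalgebra ℂ (ConvAlg (T.haar lam)) where
  carrier := {f | ∀ (α : Γ) (σ : S), f (T.act α σ) = (χ α : ℂ) * f σ}
  add_mem' {_ _} hf hg α σ := by
    rw [ConvAlg.add_apply, ConvAlg.add_apply, hf, hg, mul_add]
  zero_mem' α σ := by rw [ConvAlg.zero_apply, ConvAlg.zero_apply, mul_zero]
  mul_mem' _ hg α σ := by
    have hr : rngU (T.act α σ) = rngU σ := Subtype.ext (T.rng_act α σ)
    rw [ConvAlg.mul_apply, ConvAlg.mul_apply, hr, ← integral_const_mul]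
    refine integral_congr_ae ?_
    filter_upwards [(T.haar lam).ae_fib (rngU σ)] with τ hτ
    have hτ' : rng τ = rng σ := hτ
    rw [T.gmul_act _ _ _ (by rw [src_ginv, hτ']), hg, mul_left_comm]
  smul_mem' c f hf α σ := by
    rw [ConvAlg.smul_apply, ConvAlg.smul_apply, hf, mul_left_comm]
  star_mem' {f} hf α σ := by
    rw [ConvAlg.star_apply, ConvAlg.star_apply, T.ginv_act, hf, map_mul, map_inv,
      Circle.coe_inv_eq_conj, Complex.conj_conj]

instance (χ : Γ →ₜ* Circle) : FunLike (T.Cc lam χ) S ℂ where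
  coe f := (f : ConvAlg (T.haar lam))
  coe_injective _ _ h := Subtype.ext (DFunLike.coe_injective h)

end Haar
end Twist

namespace CStarSeminorm

/-- The supremum of the pointwise bounded family of `C*`-seminorms `a ↦ ‖φᵢ(a)‖`, where the `φᵢ`
are `*`-homomorphisms into `C*`-algebras; it is `0` if the family is empty. -/
def ofSup {A : Type*} [NonUnitalRing A] [StarRing A] [Module ℂ A] {ι : Sort*} {B : ι → Type*}
    [∀ i, NonUnitalCStarAlgebra (B i)] (φ : ∀ i, A →⋆ₙₐ[ℂ] B i)
    (hb : ∀ a, BddAbove (range fun i => ‖φ i a‖)) : CStarSeminorm A :=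
  have h0 : ∀ a, 0 ≤ ⨆ i, ‖φ i a‖ := fun a => Real.iSup_nonneg fun i => norm_nonneg _
  have hle : ∀ i a, ‖φ i a‖ ≤ ⨆ i, ‖φ i a‖ := fun i a => le_ciSup (hb a) i
  { toSeminorm := Seminorm.ofSMulLE (fun a => ⨆ i, ‖φ i a‖)
      (by simp)
      (fun a b => Real.iSup_le (fun i => by
        rw [map_add]
        exact (norm_add_le _ _).trans (add_le_add (hle i a) (hle i b))) (add_nonneg (h0 a) (h0 b)))
      (fun c a => Real.iSup_le (fun i => by
        rw [map_smul, norm_smul]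
        exact mul_le_mul_of_nonneg_left (hle i a) (norm_nonneg c))
        (mul_nonneg (norm_nonneg c) (h0 a)))
    mul_le' := fun a b => Real.iSup_le (fun i => by
        rw [map_mul]
        exact (norm_mul_le _ _).trans (mul_le_mul (hle i a) (hle i b) (norm_nonneg _) (h0 a)))
        (mul_nonneg (h0 a) (h0 b))
    star_mul_self' := fun a => by
      show (⨆ i, ‖φ i (star a * a)‖) = (⨆ i, ‖φ i a‖) * ⨆ i, ‖φ i a‖
      have h1 : ∀ i, ‖φ i (star a * a)‖ = ‖φ i a‖ * ‖φ i a‖ := fun i => by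
        rw [map_mul, map_star, CStarRing.norm_star_mul_self]
      refine le_antisymm (Real.iSup_le (fun i => ?_) (mul_nonneg (h0 a) (h0 a))) ?_
      · rw [h1]
        exact mul_le_mul (hle i a) (hle i a) (norm_nonneg _) (h0 a)
      · have h2 : (⨆ i, ‖φ i a‖) ≤ √(⨆ i, ‖φ i (star a * a)‖) := by
          refine Real.iSup_le (fun i => Real.le_sqrt_of_sq_le ?_) (Real.sqrt_nonneg _)
          rw [pow_two, ← h1]
          exact le_ciSup (hb (star a * a)) i
        calc _ ≤ √(⨆ i, ‖φ i (star a * a)‖) * √(⨆ i, ‖φ i (star a * a)‖) :=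
              mul_le_mul h2 h2 (h0 a) (Real.sqrt_nonneg _)
          _ = _ := Real.mul_self_sqrt (h0 _) }

theorem ofSup_apply {A : Type*} [NonUnitalRing A] [StarRing A] [Module ℂ A] {ι : Sort*}
    {B : ι → Type*} [∀ i, NonUnitalCStarAlgebra (B i)] (φ : ∀ i, A →⋆ₙₐ[ℂ] B i)
    (hb : ∀ a, BddAbove (range fun i => ‖φ i a‖)) (a : A) :
    (ofSup φ hb).toSeminorm a = ⨆ i, ‖φ i a‖ := rfl

end CStarSeminorm

/-- A representation of the `*`-algebra `A` on a Hilbert space that is bounded by `I`. (A supremum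
of `‖L(a)‖` over all of these is unchanged if one restricts to the cyclic ones, so the Hilbert
spaces in the universe of `A` suffice.) -/
structure IRep (A : Type u) [NonUnitalRing A] [StarRing A] [Module ℂ A] (I : A → ℝ) :
    Type (u + 1) where
  K : Type u
  [normed : NormedAddCommGroup K]
  [innerProduct : InnerProductSpace ℂ K]
  [complete : CompleteSpace K]
  L : A →⋆ₙₐ[ℂ] (K →L[ℂ] K)
  bound : ∀ a, ‖L a‖ ≤ I a

attribute [instance] IRep.normed IRep.innerProduct IRep.complete

namespace Twist

variable {Γ G : Type*} {S : Type u} [CommGroup Γ] [TopologicalSpace Γ] [IsTopologicalGroup Γ]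
    [CompactSpace Γ] [T2Space Γ] [MeasurableSpace Γ] [BorelSpace Γ]
    [TopologicalSpace G] [T2Space G] [LocallyCompactSpace G]
    [MeasurableSpace G] [BorelSpace G] [ArrowGroupoid G] [IsTopologicalGroupoid G]
    [TopologicalSpace S] [T2Space S] [LocallyCompactSpace S]
    [MeasurableSpace S] [BorelSpace S] [ArrowGroupoid S] [IsTopologicalGroupoid S]
    (T : Twist Γ G S) (lam : HaarSystem G) (χ : Γ →ₜ* Circle)

/-- The representations of `C_c(S; G; χ)` that are bounded by the `I`-norm. -/
abbrev Rep : Type (u + 1) :=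
  IRep (T.Cc lam χ) fun f => (T.haar lam).iNorm (f : ConvAlg (T.haar lam))

/-- The full norm on `C_c(S; G; χ)`: the supremum of `‖L(f)‖` over all representations `L` that are
bounded by the `I`-norm. -/
def fullNorm : CStarSeminorm (T.Cc lam χ) :=
  CStarSeminorm.ofSup (fun L : T.Rep lam χ => L.L) fun f =>
    ⟨_, by rintro _ ⟨L, rfl⟩; exact L.bound f⟩

/-- The reduced norm on `C_c(S; G; χ)`: the supremum over all units `u` of `‖Ind δᵤ(f)‖`, where
`Ind δᵤ` is the regular representation on `L²(Sᵤ, μᵤ)`. -/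
def reducedNorm : CStarSeminorm (T.Cc lam χ) :=
  CStarSeminorm.ofSup
    (fun u => ((T.haar lam).ind u).comp (NonUnitalStarSubalgebraClass.subtype (T.Cc lam χ)))
    fun f => ⟨_, by rintro _ ⟨u, rfl⟩; exact (T.haar lam).norm_indOp_le u f⟩

/-- The full `C*`-algebra `C*(S; G; χ)`. -/
abbrev FullCStar : Type _ := (T.fullNorm lam χ).Compl

/-- The reduced `C*`-algebra `C*_r(S; G; χ)`. -/
abbrev ReducedCStar : Type _ := (T.reducedNorm lam χ).Compl

/-- The canonical map from `C_c(S; G; χ)` to the full `C*`-algebra. -/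
abbrev toFull : T.Cc lam χ →⋆ₙₐ[ℂ] T.FullCStar lam χ := CStarSeminorm.Compl.of _

/-- The canonical map from `C_c(S; G; χ)` to the reduced `C*`-algebra. -/
abbrev toReduced : T.Cc lam χ →⋆ₙₐ[ℂ] T.ReducedCStar lam χ := CStarSeminorm.Compl.of _

end Twist

end

/-!
A morphism of twists `φ : S → S'` over the identity of `G` need not be injective or surjective, but
the translates of its image under `Γ'` fill `S'`, as `π' ∘ φ = π` and the fibres of `π'` are the
orbits of `Γ'`. Hence `(α', σ) ↦ α' · φ(σ)` maps `Γ' × S` onto `S'`. As `Γ` is compact, `π` is proper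
(`Twist.isCompact_preimage_proj`), so this map is proper and therefore a quotient map
(`Twist.Morphism.isQuotientMap_act`). For `f ∈ C_c(S; G; χ' ∘ θ)` the function
`(α', σ) ↦ χ'(α') f(σ)` descends along it, because `Γ'` acts freely; this is the unique `f'` with
`f' ∘ φ = f`. So composition with `φ` is a bijection `C_c(S'; G; χ') → C_c(S; G; χ' ∘ θ)`.

All the integrals that matter have `Γ`-invariant integrands, and the integral of an invariant
function is the integral over `G` of the function it induces there; this does not depend on the
twist (`Twist.Morphism.integral_comp`). Therefore composition with `φ` respects convolution, the
`I`-norms and the `L²`-norms. Equality of the `I`-norms gives equality of the full norms, since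
representations can be transported. The operator `Ind δᵤ(f)` acts on the whole of `L²(S_u)`, but for
equivariant `f` one has `f * g = f * Pg` with `P` the contractive projection onto the equivariant
functions (`Twist.isotypic`), so that its norm is determined on these
(`Twist.norm_ind_le_iff`) and agrees with the one for `S'`. An isomorphism that preserves
`C*`-seminorms extends to the completions.
-/

noncomputable section

open ArrowGroupoid

/-! ### Extension of isomorphisms to completions -/

namespace CStarSeminorm

section Completion

variable {A B : Type*} [NonUnitalRing A] [StarRing A] [Module ℂ A] [IsScalarTower ℂ A A]
  [SMulCommClass ℂ A A] [StarModule ℂ A] [NonUnitalRing B] [StarRing B] [Module ℂ B]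
  [IsScalarTower ℂ B B] [SMulCommClass ℂ B B] [StarModule ℂ B]
  {p : CStarSeminorm A} {q : CStarSeminorm B}

theorem exists_compl_hom (φ : A →⋆ₙₐ[ℂ] B) (h : ∀ a, q.toSeminorm (φ a) ≤ p.toSeminorm a) :
    ∃ Φ : p.Compl →⋆ₙₐ[ℂ] q.Compl, Continuous Φ ∧ ∀ a, Φ (Compl.of p a) = Compl.of q (φ a) := by
  let ψ : A →⋆ₙₐ[ℂ] q.Compl := (Compl.of q).comp φ
  let l : p.Pre →ₗ[ℂ] q.Compl :=
    { toFun := ψ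
      map_add' := fun a b => map_add ψ a b
      map_smul' := fun c a => map_smul ψ c a }
  let L : p.Pre →L[ℂ] q.Compl := l.mkContinuous 1 fun a => by
    rw [one_mul]
    exact (Compl.norm_of q (φ a)).trans_le (h a)
  let Φ : p.Compl →L[ℂ] q.Compl := L.extend (Compl.ofL p)
  have hΦ : ∀ a, Φ (Compl.of' p a) = ψ a := fun a =>
    ContinuousLinearMap.extend_eq L (Compl.denseRange_ofL p) (Compl.isUniformInducing_ofL p) a
  refine ⟨{ toFun := Φ
            map_smul' := fun c a => map_smul Φ c a
            map_zero' := map_zero Φ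
            map_add' := map_add Φ
            map_mul' := fun a b => ?_
            map_star' := fun a => ?_ }, Φ.continuous, hΦ⟩
  · refine Compl.induction_on₂ p a b (isClosed_eq (by fun_prop) (by fun_prop)) fun a b => ?_
    rw [Compl.mul_of', hΦ, hΦ, hΦ]
    exact map_mul ψ a b
  · refine Compl.induction_on p a (isClosed_eq (by fun_prop) (by fun_prop)) fun a => ?_
    rw [Compl.star_of', hΦ, hΦ]
    exact map_star ψ a

/-- A `*`-isomorphism that preserves the seminorms extends to the completions. -/
theorem exists_compl_equiv (e : A ≃⋆ₐ[ℂ] B) (h : ∀ a, q.toSeminorm (e a) = p.toSeminorm a) :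
    ∃ Φ : p.Compl ≃⋆ₐ[ℂ] q.Compl, ∀ a, Φ (Compl.of p a) = Compl.of q (e a) := by
  obtain ⟨Φ, hc, hΦ⟩ := exists_compl_hom (p := p) (q := q) (e : A →⋆ₙₐ[ℂ] B) fun a => (h a).le
  obtain ⟨Ψ, hc', hΨ⟩ := exists_compl_hom (p := q) (q := p) (e.symm : B →⋆ₙₐ[ℂ] A) fun b => by
    have h1 := h (e.symm b)
    rw [StarAlgEquiv.apply_symm_apply] at h1
    exact h1.ge
  have h1 : ∀ x, Ψ (Φ x) = x := congrFun <|
    (Compl.denseRange_of p).equalizer (hc'.comp hc) continuous_id <| funext fun a => by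
      show Ψ (Φ (Compl.of p a)) = Compl.of p a
      rw [hΦ, hΨ]
      exact congrArg _ (e.symm_apply_apply a)
  have h2 : ∀ x, Φ (Ψ x) = x := congrFun <|
    (Compl.denseRange_of q).equalizer (hc.comp hc') continuous_id <| funext fun b => by
      show Φ (Ψ (Compl.of q b)) = Compl.of q b
      rw [hΨ, hΦ]
      exact congrArg _ (e.apply_symm_apply b)
  exact ⟨StarAlgEquiv.ofBijective Φ (Function.bijective_iff_has_inverse.2 ⟨Ψ, h1, h2⟩), hΦ⟩

end Completion

end CStarSeminorm

/-! ### The quotient map of a twist -/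

namespace Twist

section Orbits

variable {Γ G S : Type*} [CommGroup Γ] [TopologicalSpace Γ]
    [TopologicalSpace G] [ArrowGroupoid G] [TopologicalSpace S] [ArrowGroupoid S]
    (T : Twist Γ G S)

/-- The action of `Γ` on `S` is free. -/
theorem act_left_injective (σ : S) : Function.Injective fun α => T.act α σ := by
  intro α β h
  have key : ∀ α, T.act α σ ⋄ ginv σ = T.incl (rngU (T.proj σ), α) := fun α => by
    have h1 := T.composable α σ
    rw [act, gmul_assoc _ _ _ h1 (rng_ginv σ).symm, gmul_ginv, ← h1, gmul_src]
  have h2 : T.act α σ ⋄ ginv σ = T.act β σ ⋄ ginv σ := congrArg (· ⋄ ginv σ) h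
  rw [key, key] at h2
  exact congrArg Prod.snd (T.incl_isEmbedding.injective h2)

variable [IsTopologicalGroupoid G] [IsTopologicalGroupoid S]

theorem continuous_act_right (α : Γ) : Continuous (T.act α) :=
  T.continuous_act.comp (by fun_prop : Continuous fun σ : S => (α, σ))

theorem continuous_act_left (σ : S) : Continuous fun α => T.act α σ :=
  T.continuous_act.comp (by fun_prop : Continuous fun α : Γ => (α, σ))

/-- As `G` carries the quotient topology and the fibres of `π` are the orbits of `Γ`, the map `π`
is open. -/
theorem isOpenMap_proj : IsOpenMap T.proj := by
  intro U hU
  rw [← T.proj_isQuotientMap.isOpen_preimage]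
  have h : T.proj ⁻¹' (T.proj '' U) = ⋃ α, T.act α ⁻¹' U := by
    ext σ
    simp only [mem_preimage, mem_image, mem_iUnion]
    constructor
    · rintro ⟨τ, hτ, h⟩
      obtain ⟨α, hα⟩ := T.exists_act σ τ h.symm
      exact ⟨α, hα ▸ hτ⟩
    · rintro ⟨α, hα⟩
      exact ⟨_, hα, T.proj_act α σ⟩
  rw [h]
  exact isOpen_iUnion fun α => hU.preimage (T.continuous_act_right α)

/-- The map `π` is proper: over a compact set it lies in `Γ · L` for a compact `L`. -/
theorem isCompact_preimage_proj [CompactSpace Γ] [LocallyCompactSpace S] [T2Space G] {K : Set G}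
    (hK : IsCompact K) : IsCompact (T.proj ⁻¹' K) := by
  choose L hL hmem using fun σ : S => exists_compact_mem_nhds σ
  obtain ⟨t, ht⟩ := hK.elim_finite_subcover (fun σ : S => T.proj '' interior (L σ))
    (fun σ => T.isOpenMap_proj _ isOpen_interior) fun γ _ => by
      obtain ⟨σ, rfl⟩ := T.proj_isQuotientMap.surjective γ
      exact mem_iUnion.2 ⟨σ, σ, mem_interior_iff_mem_nhds.2 (hmem σ), rfl⟩
  have hL' : IsCompact (⋃ σ ∈ t, L σ) := t.isCompact_biUnion fun σ _ => hL σ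
  refine ((isCompact_univ.prod hL').image T.continuous_act).of_isClosed_subset
    (hK.isClosed.preimage T.continuous_proj) fun τ hτ => ?_
  obtain ⟨σ, hσ, ρ, hρ, h⟩ := mem_iUnion₂.1 (ht hτ)
  obtain ⟨α, hα⟩ := T.exists_act ρ τ h
  exact ⟨(α, ρ), ⟨mem_univ _, mem_biUnion hσ (interior_subset hρ)⟩, hα⟩

end Orbits
end Twist

namespace Twist

/-! ### Integration over the fibres of a twist -/

theorem act_gmul {Γ G S : Type*} [CommGroup Γ] [TopologicalSpace Γ]
    [TopologicalSpace G] [ArrowGroupoid G] [TopologicalSpace S] [ArrowGroupoid S]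
    (T : Twist Γ G S) (α : Γ) (τ σ : S) (h : src τ = rng σ) :
    T.act α τ ⋄ σ = T.act α (τ ⋄ σ) := by
  have h1 : rngU (T.proj (τ ⋄ σ)) = rngU (T.proj τ) := Subtype.ext <| by
    show rng (T.proj (τ ⋄ σ)) = rng (T.proj τ)
    rw [rng_hom T.proj_hom, rng_gmul _ _ h, rng_hom T.proj_hom]
  rw [act, act, h1, gmul_assoc _ _ _ (T.composable α τ) h]

section Integral

variable {Γ G S : Type*} [CommGroup Γ] [TopologicalSpace Γ] [IsTopologicalGroup Γ]
    [CompactSpace Γ] [T2Space Γ] [MeasurableSpace Γ] [BorelSpace Γ]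
    [TopologicalSpace G] [T2Space G] [LocallyCompactSpace G]
    [MeasurableSpace G] [BorelSpace G] [ArrowGroupoid G] [IsTopologicalGroupoid G]
    [TopologicalSpace S] [T2Space S] [LocallyCompactSpace S]
    [MeasurableSpace S] [BorelSpace S] [ArrowGroupoid S] [IsTopologicalGroupoid S]
    (T : Twist Γ G S) (lam : HaarSystem G)

instance : IsProbabilityMeasure (normHaar Γ) where
  measure_univ := by
    have h := Measure.haarMeasure_self (G := Γ) (K₀ := ⊤)
    rwa [TopologicalSpace.PositiveCompacts.coe_top] at h

/-- The defining formula of `μᵘ`, for functions which are only continuous on one fibre. -/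
theorem integral_haar (h : S → ℂ) (u : unitSpace S) (hc : Continuous fun x : Fib u => h x)
    (hs : HasCompactSupport fun x : Fib u => h x) :
    ∫ σ, h σ ∂(T.haar lam).meas u = ∫ γ, T.avg h γ ∂lam.meas (rngU (T.proj u)) := by
  obtain ⟨F, hF⟩ := exists_cc_extension (isClosed_fib u).isClosedEmbedding_subtypeVal hc hs
  have h1 : ∫ σ, h σ ∂(T.haar lam).meas u = ∫ σ, F σ ∂T.inducedMeas lam u := by
    refine integral_congr_ae ?_
    filter_upwards [(T.haar lam).ae_fib u] with σ hσ using (hF ⟨σ, hσ⟩).symm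
  rw [h1, T.integral_inducedMeas lam]
  refine integral_congr_ae ?_
  filter_upwards [lam.ae_fib (rngU (T.proj u))] with γ hγ
  refine integral_congr_ae (ae_of_all _ fun α => hF ⟨T.act α (T.sec γ), ?_⟩)
  show rng (T.act α (T.sec γ)) = u
  rw [T.rng_act, T.rng_eq_iff, T.proj_sec, hγ]

theorem integral_haar_real (h : S → ℝ) (u : unitSpace S) (hc : Continuous fun x : Fib u => h x)
    (hs : HasCompactSupport fun x : Fib u => h x) :
    ∫ σ, h σ ∂(T.haar lam).meas u = ∫ γ, T.avg h γ ∂lam.meas (rngU (T.proj u)) := by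
  have key := T.integral_haar lam (fun σ => (h σ : ℂ)) u (Complex.continuous_ofReal.comp hc)
    (hs.comp_left (g := fun r : ℝ => (r : ℂ)) Complex.ofReal_zero)
  have h1 : T.avg (fun σ => (h σ : ℂ)) = fun γ => ((T.avg h γ : ℝ) : ℂ) :=
    funext fun γ => integral_ofReal
  rw [h1] at key
  exact Complex.ofReal_injective (integral_ofReal.symm.trans (key.trans integral_ofReal))

theorem avg_of_invariant {h : S → ℂ} {σ : S} (hi : ∀ α, h (T.act α σ) = h σ) :
    T.avg h (T.proj σ) = h σ := by
  rw [avg_proj]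
  simp [hi]

variable {T lam}

/-- The integrand of a convolution of two `χ`-equivariant functions is `Γ`-invariant. -/
theorem mul_integrand_act {χ : Γ →ₜ* Circle} (f g : T.Cc lam χ) (α : Γ) (τ σ : S)
    (h : rng τ = rng σ) :
    f (T.act α τ) * g (ginv (T.act α τ) ⋄ σ) = f τ * g (ginv τ ⋄ σ) := by
  have hf : f (T.act α τ) = χ α * f τ := f.2 α τ
  have hg : g (T.act α⁻¹ (ginv τ ⋄ σ)) = χ α⁻¹ * g (ginv τ ⋄ σ) := g.2 α⁻¹ _
  rw [T.ginv_act, T.act_gmul _ _ _ (by rw [src_ginv, h]), hf, hg, map_inv]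
  have : (χ α : ℂ) * ((χ α)⁻¹ : Circle) = 1 := by
    rw [← Circle.coe_mul, mul_inv_cancel, Circle.coe_one]
  linear_combination (f τ * g (ginv τ ⋄ σ)) * this

end Integral

/-! ### Restriction to the equivariant functions -/

section Isotypic

variable {Γ G S : Type*} [CommGroup Γ] [TopologicalSpace Γ] [IsTopologicalGroup Γ]
    [CompactSpace Γ] [T2Space Γ] [MeasurableSpace Γ] [BorelSpace Γ]
    [TopologicalSpace G] [T2Space G] [LocallyCompactSpace G]
    [MeasurableSpace G] [BorelSpace G] [ArrowGroupoid G] [IsTopologicalGroupoid G]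
    [TopologicalSpace S] [T2Space S] [LocallyCompactSpace S]
    [MeasurableSpace S] [BorelSpace S] [ArrowGroupoid S] [IsTopologicalGroupoid S]
    (T : Twist Γ G S) (lam : HaarSystem G) (χ : Γ →ₜ* Circle)

theorem continuous_coe_character : Continuous fun α => (χ α : ℂ) :=
  continuous_subtype_val.comp χ.continuous_toFun

/-- The projection of `C_c(S)` onto its `χ`-equivariant part: `σ ↦ ∫ χ(α) g(α⁻¹ · σ) dα`. -/
def isotypic (g : ConvAlg (T.haar lam)) : T.Cc lam χ :=
  ⟨(⟨⟨fun σ => ∫ α, (χ α : ℂ) * g (T.act α⁻¹ σ) ∂normHaar Γ, by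
      refine continuousOn_univ.1 (continuousOn_integral_of_compact_support (k := univ)
        isCompact_univ ?_ (fun _ _ _ h => absurd (mem_univ _) h))
      refine Continuous.continuousOn (((continuous_coe_character χ).comp continuous_snd).mul
        (g.continuous.comp (T.continuous_act.comp (f := fun p : S × Γ => (p.2⁻¹, p.1)) ?_)))
      exact (continuous_inv.comp continuous_snd).prodMk continuous_fst⟩, by
      refine HasCompactSupport.intro ((isCompact_univ.prod g.hasCompactSupport.isCompact).image
        T.continuous_act) fun σ hσ => integral_eq_zero_of_ae (ae_of_all _ fun α => ?_)
      by_contra h0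
      refine hσ ⟨(α, T.act α⁻¹ σ), ⟨mem_univ _, subset_tsupport _ (right_ne_zero_of_mul h0)⟩, ?_⟩
      show T.act α (T.act α⁻¹ σ) = σ
      rw [T.act_act, mul_inv_cancel, T.act_one]⟩ : C_c(S, ℂ)), fun β σ => by
    show ∫ α, (χ α : ℂ) * g (T.act α⁻¹ (T.act β σ)) ∂normHaar Γ =
      (χ β : ℂ) * ∫ α, (χ α : ℂ) * g (T.act α⁻¹ σ) ∂normHaar Γ
    rw [← integral_mul_left_eq_self _ β, ← integral_const_mul]
    refine integral_congr_ae (ae_of_all _ fun α => ?_)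
    simp only [T.act_act, map_mul, Circle.coe_mul, mul_inv_rev, mul_assoc, inv_mul_cancel, mul_one]⟩

theorem isotypic_apply (g : ConvAlg (T.haar lam)) (σ : S) :
    T.isotypic lam χ g σ = ∫ α, (χ α : ℂ) * g (T.act α⁻¹ σ) ∂normHaar Γ := rfl

variable {T lam χ}

/-- Left convolution by a `χ`-equivariant function only sees the `χ`-equivariant part. -/
theorem mul_isotypic (f : T.Cc lam χ) (g : ConvAlg (T.haar lam)) :
    (f : ConvAlg (T.haar lam)) * (T.isotypic lam χ g : ConvAlg (T.haar lam)) = f * g := by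
  refine ConvAlg.ext fun σ => ?_
  set F : ConvAlg (T.haar lam) := (f : ConvAlg (T.haar lam)) with hF
  set P : ConvAlg (T.haar lam) := (T.isotypic lam χ g : ConvAlg (T.haar lam)) with hP
  have h1 := HaarSystem.conv_integrand F.toCc P.toCc σ
  have h2 := HaarSystem.conv_integrand F.toCc g.toCc σ
  rw [ConvAlg.mul_apply, ConvAlg.mul_apply]
  refine (T.integral_haar lam (fun τ => F τ * P (ginv τ ⋄ σ)) _ h1.1 h1.2).trans
    (Eq.trans ?_ (T.integral_haar lam (fun τ => F τ * g (ginv τ ⋄ σ)) _ h2.1 h2.2).symm)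
  refine integral_congr_ae ?_
  filter_upwards [lam.ae_fib _] with γ hγ
  have hr : rng (T.sec γ) = rng σ := by
    have := (T.rng_eq_iff (T.sec γ) (rngU σ)).2 (by rw [T.proj_sec, hγ])
    exact this
  have h3 := T.avg_of_invariant (h := fun τ => F τ * P (ginv τ ⋄ σ)) (σ := T.sec γ)
    fun α => mul_integrand_act f (T.isotypic lam χ g) α _ σ hr
  rw [T.proj_sec] at h3
  rw [h3]
  show F (T.sec γ) * T.isotypic lam χ g (ginv (T.sec γ) ⋄ σ) = _
  rw [isotypic_apply, avg, ← integral_const_mul]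
  refine integral_congr_ae (ae_of_all _ fun α => ?_)
  have h4 : F (T.act α (T.sec γ)) = χ α * F (T.sec γ) := f.2 α _
  simp only []
  rw [T.ginv_act, T.act_gmul _ _ _ (by rw [src_ginv, hr]), h4]
  ring

theorem sq_norm_integral_le {X : Type*} [MeasurableSpace X] {μ : Measure X}
    [IsProbabilityMeasure μ] {k : X → ℂ} (hk : Integrable k μ)
    (hk2 : Integrable (fun x => ‖k x‖ ^ 2) μ) : ‖∫ x, k x ∂μ‖ ^ 2 ≤ ∫ x, ‖k x‖ ^ 2 ∂μ := by
  set m := ∫ x, ‖k x‖ ∂μ with hm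
  have h1 : ‖∫ x, k x ∂μ‖ ≤ m := norm_integral_le_integral_norm _
  -- the variance of `‖k‖` is nonnegative
  have h2 : 0 ≤ ∫ x, (‖k x‖ ^ 2 - 2 * m * ‖k x‖ + m ^ 2) ∂μ :=
    integral_nonneg fun x => by
      show 0 ≤ ‖k x‖ ^ 2 - 2 * m * ‖k x‖ + m ^ 2
      nlinarith [sq_nonneg (‖k x‖ - m)]
  have i1 : Integrable (fun x => ‖k x‖ ^ 2 - 2 * m * ‖k x‖) μ := hk2.sub (hk.norm.const_mul _)
  rw [integral_add i1 (integrable_const _),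
    integral_sub hk2 (hk.norm.const_mul _), integral_const_mul, ← hm] at h2
  simp only [integral_const, probReal_univ, one_smul] at h2
  have h3 : ‖∫ x, k x ∂μ‖ ^ 2 ≤ m ^ 2 := by gcongr
  nlinarith

theorem norm_sq_toL2_eq_avg (u : unitSpace S) (g : ConvAlg (T.haar lam)) :
    ‖(T.haar lam).toL2 u g‖ ^ 2 =
      ∫ γ, T.avg (fun τ => ‖g (ginv τ)‖ ^ 2) γ ∂lam.meas (rngU (T.proj u)) := by
  have h := (T.haar lam).fib_ginv_cc u g
  rw [(T.haar lam).norm_sq_toL2, (T.haar lam).integral_fm u fun τ => ‖g (ginv τ)‖ ^ 2]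
  exact T.integral_haar_real lam _ u (h.1.norm.pow 2)
    (h.2.comp_left (g := fun z : ℂ => ‖z‖ ^ 2) (by simp))

theorem integrable_avg_norm_sq (u : unitSpace G) (g : ConvAlg (T.haar lam)) :
    Integrable (T.avg fun τ => ‖g (ginv τ)‖ ^ 2) (lam.meas u) := by
  have hc : Continuous fun τ => g (ginv τ) := g.continuous.comp continuous_ginv'
  have hs : HasCompactSupport fun τ => g (ginv τ) :=
    g.hasCompactSupport.comp_homeomorph (ginvHomeo S)
  have hs2 : HasCompactSupport fun τ => ‖g (ginv τ)‖ ^ 2 :=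
    hs.comp_left (g := fun z : ℂ => ‖z‖ ^ 2) (by simp)
  have hc2 : Continuous fun τ => ‖g (ginv τ)‖ ^ 2 := hc.norm.pow 2
  exact T.integrable_avg lam hc2 hs2 u

theorem norm_toL2_isotypic_le (u : unitSpace S) (g : ConvAlg (T.haar lam)) :
    ‖(T.haar lam).toL2 u (T.isotypic lam χ g : ConvAlg (T.haar lam))‖ ≤
      ‖(T.haar lam).toL2 u g‖ := by
  refine le_of_sq_le_sq ?_ (norm_nonneg _)
  rw [norm_sq_toL2_eq_avg, norm_sq_toL2_eq_avg]
  refine integral_mono (integrable_avg_norm_sq _ _) (integrable_avg_norm_sq _ _) fun γ => ?_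
  set s := T.sec γ
  have hP : ∀ α, ‖T.isotypic lam χ g (ginv (T.act α s))‖ ^ 2 =
      ‖∫ α, (χ α : ℂ) * g (ginv (T.act α s)) ∂normHaar Γ‖ ^ 2 := fun α => by
    have : T.isotypic lam χ g (T.act α⁻¹ (ginv s)) = χ α⁻¹ * T.isotypic lam χ g (ginv s) :=
      (T.isotypic lam χ g).2 α⁻¹ _
    rw [T.ginv_act, this, norm_mul, Circle.norm_coe, one_mul, isotypic_apply]
    simp_rw [T.ginv_act]
  have hc : Continuous fun α => (χ α : ℂ) * g (ginv (T.act α s)) :=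
    (continuous_coe_character χ).mul
      (g.continuous.comp (continuous_ginv'.comp (T.continuous_act_left s)))
  have key := sq_norm_integral_le (μ := normHaar Γ)
    (hc.integrable_of_hasCompactSupport (HasCompactSupport.of_compactSpace _))
    ((hc.norm.pow 2).integrable_of_hasCompactSupport (HasCompactSupport.of_compactSpace _))
  calc _ = ∫ _ : Γ, ‖∫ α, (χ α : ℂ) * g (ginv (T.act α s)) ∂normHaar Γ‖ ^ 2 ∂normHaar Γ :=
        integral_congr_ae (ae_of_all _ hP)
    _ ≤ _ := by
        simp only [integral_const, probReal_univ, one_smul]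
        simp only [norm_mul, Circle.norm_coe, one_mul] at key
        exact key

/-- The norm of `Ind δᵤ(f)`, for a `χ`-equivariant `f`, is attained on the `χ`-equivariant
functions. -/
theorem norm_ind_le_iff (u : unitSpace S) (f : T.Cc lam χ) {C : ℝ} (hC : 0 ≤ C) :
    ‖(T.haar lam).ind u (f : ConvAlg (T.haar lam))‖ ≤ C ↔ ∀ g : T.Cc lam χ,
      ‖(T.haar lam).toL2 u ((f * g : T.Cc lam χ) : ConvAlg (T.haar lam))‖ ≤
        C * ‖(T.haar lam).toL2 u (g : ConvAlg (T.haar lam))‖ := by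
  constructor
  · intro h g
    have h1 := (T.haar lam).indOp_toL2 u (f : ConvAlg (T.haar lam)) g
    show ‖(T.haar lam).toL2 u ((f : ConvAlg (T.haar lam)) * (g : ConvAlg (T.haar lam)))‖ ≤ _
    rw [← h1]
    exact ContinuousLinearMap.le_of_opNorm_le _ h _
  · intro h
    refine LinearMap.opNorm_extendOfNorm_le ((T.haar lam).denseRange_toL2 u) hC fun g => ?_
    have h1 := h (T.isotypic lam χ g)
    refine Eq.trans_le ?_ (h1.trans
      (mul_le_mul_of_nonneg_left (norm_toL2_isotypic_le u g) hC))
    exact congrArg (fun x => ‖(T.haar lam).toL2 u x‖) (mul_isotypic f g).symm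

end Isotypic
end Twist

/-! ### Morphisms of twists -/

namespace Twist

/-- A morphism of twists over `G` along a continuous homomorphism `θ : Γ → Γ'`: a continuous
groupoid homomorphism `S → S'` that is `θ` on the included bundles and the identity on `G`. -/
structure Morphism {Γ Γ' G S S' : Type*} [CommGroup Γ] [TopologicalSpace Γ]
    [CommGroup Γ'] [TopologicalSpace Γ'] [TopologicalSpace G] [ArrowGroupoid G]
    [TopologicalSpace S] [ArrowGroupoid S] [TopologicalSpace S'] [ArrowGroupoid S']
    (T : Twist Γ G S) (T' : Twist Γ' G S') (θ : Γ →ₜ* Γ') where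
  toFun : S → S'
  continuous : Continuous toFun
  hom : IsGroupoidHom toFun
  map_incl : ∀ (u : unitSpace G) (α : Γ), toFun (T.incl (u, α)) = T'.incl (u, θ α)
  proj_map : ∀ σ, T'.proj (toFun σ) = T.proj σ

namespace Morphism

section Topology

variable {Γ Γ' G S S' : Type*} [CommGroup Γ] [TopologicalSpace Γ]
    [CommGroup Γ'] [TopologicalSpace Γ'] [TopologicalSpace G] [ArrowGroupoid G]
    [TopologicalSpace S] [ArrowGroupoid S] [TopologicalSpace S'] [ArrowGroupoid S']
    {T : Twist Γ G S} {T' : Twist Γ' G S'} {θ : Γ →ₜ* Γ'} (φ : Morphism T T' θ)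

theorem map_act (α : Γ) (σ : S) : φ.toFun (T.act α σ) = T'.act (θ α) (φ.toFun σ) := by
  rw [act, (φ.hom _ _ (T.composable α σ)).2, φ.map_incl, act, φ.proj_map]

theorem map_rng (σ : S) : φ.toFun (rng σ) = rng (φ.toFun σ) := (rng_hom φ.hom σ).symm

theorem map_ginv (σ : S) : φ.toFun (ginv σ) = ginv (φ.toFun σ) := by
  obtain ⟨h1, h2⟩ := φ.hom σ (ginv σ) (rng_ginv σ).symm
  exact eq_ginv_of_gmul _ _ h1 (by rw [← h2, gmul_ginv, map_rng])

/-- The induced map on unit spaces. -/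
def unitMap (u : unitSpace S) : unitSpace S' :=
  ⟨φ.toFun u, by
    show src (φ.toFun u) = φ.toFun u
    rw [src_hom φ.hom, src_unit]⟩

theorem unitMap_surjective : Function.Surjective φ.unitMap := by
  intro v
  have h : (v : S') ∈ range fun u => T'.incl (u, 1) := T'.units_eq ▸ v.2
  obtain ⟨u, hu⟩ := h
  have h1 : T.incl (u, 1) ∈ unitSpace S := T.units_eq ▸ mem_range_self u
  refine ⟨⟨_, h1⟩, Subtype.ext ?_⟩
  show φ.toFun (T.incl (u, 1)) = v
  rw [φ.map_incl, map_one, ← hu]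

theorem rngU_map (σ : S) : rngU (φ.toFun σ) = φ.unitMap (rngU σ) :=
  Subtype.ext (φ.map_rng σ).symm

/-- Every element of `S'` is a translate of an element in the image of `S`. -/
theorem exists_act_map (σ' : S') : ∃ (α' : Γ') (σ : S), T'.act α' (φ.toFun σ) = σ' := by
  obtain ⟨σ, hσ⟩ := T.proj_isQuotientMap.surjective (T'.proj σ')
  obtain ⟨α', h⟩ := T'.exists_act (φ.toFun σ) σ' (by rw [φ.proj_map, hσ])
  exact ⟨α', σ, h⟩

variable [CompactSpace Γ] [T2Space G] [IsTopologicalGroupoid G] [IsTopologicalGroupoid S]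
  [LocallyCompactSpace S] [T2Space S']

theorem isCompact_preimage {K : Set S'} (hK : IsCompact K) : IsCompact (φ.toFun ⁻¹' K) :=
  (T.isCompact_preimage_proj (hK.image T'.continuous_proj)).of_isClosed_subset
    (hK.isClosed.preimage φ.continuous) fun σ hσ => ⟨_, hσ, φ.proj_map σ⟩

/-- `S'` is the quotient of `Γ' × S` by the equivalence relation `(α' θ(α), σ) ∼ (α', α · σ)`: the
map `(α', σ) ↦ α' · φ(σ)` is surjective, and it is proper since `π` is. -/
theorem isQuotientMap_act [CompactSpace Γ'] [LocallyCompactSpace S'] [IsTopologicalGroupoid S'] :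
    IsQuotientMap fun p : Γ' × S => T'.act p.1 (φ.toFun p.2) := by
  have hc : Continuous fun p : Γ' × S => T'.act p.1 (φ.toFun p.2) :=
    T'.continuous_act.comp (f := fun p : Γ' × S => (p.1, φ.toFun p.2))
      (continuous_fst.prodMk (φ.continuous.comp continuous_snd))
  have hp : IsProperMap fun p : Γ' × S => T'.act p.1 (φ.toFun p.2) := by
    refine isProperMap_iff_isCompact_preimage.2 ⟨hc, fun K hK => ?_⟩
    refine (isCompact_univ.prod (T.isCompact_preimage_proj
      (hK.image T'.continuous_proj))).of_isClosed_subset (hK.isClosed.preimage hc) ?_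
    intro p hp
    exact ⟨mem_univ _, _, hp, by rw [T'.proj_act, φ.proj_map]⟩
  refine hp.isClosedMap.isQuotientMap hc fun σ' => ?_
  obtain ⟨α', σ, h⟩ := φ.exists_act_map σ'
  exact ⟨(α', σ), h⟩

end Topology

/-! ### Transfer of equivariant functions -/

section Transfer

variable {Γ Γ' G S S' : Type*}
    [CommGroup Γ] [TopologicalSpace Γ] [IsTopologicalGroup Γ] [CompactSpace Γ] [T2Space Γ]
    [MeasurableSpace Γ] [BorelSpace Γ]
    [CommGroup Γ'] [TopologicalSpace Γ'] [IsTopologicalGroup Γ'] [CompactSpace Γ'] [T2Space Γ']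
    [MeasurableSpace Γ'] [BorelSpace Γ']
    [TopologicalSpace G] [T2Space G] [LocallyCompactSpace G] [MeasurableSpace G] [BorelSpace G]
    [ArrowGroupoid G] [IsTopologicalGroupoid G]
    [TopologicalSpace S] [T2Space S] [LocallyCompactSpace S] [MeasurableSpace S] [BorelSpace S]
    [ArrowGroupoid S] [IsTopologicalGroupoid S]
    [TopologicalSpace S'] [T2Space S'] [LocallyCompactSpace S'] [MeasurableSpace S'] [BorelSpace S']
    [ArrowGroupoid S'] [IsTopologicalGroupoid S']
    {T : Twist Γ G S} {T' : Twist Γ' G S'} {θ : Γ →ₜ* Γ'} (φ : Morphism T T' θ)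
    (lam : HaarSystem G) (χ' : Γ' →ₜ* Circle)

/-- For a `Γ'`-invariant function both integrals are the integral over `G` of the function that it
induces there. -/
theorem integral_comp (h : S' → ℂ) (u : unitSpace S)
    (hc : Continuous fun x : Fib (φ.unitMap u) => h x)
    (hs : HasCompactSupport fun x : Fib (φ.unitMap u) => h x)
    (hi : ∀ (α : Γ') (τ : S'), rng τ = (φ.unitMap u : S') → h (T'.act α τ) = h τ) :
    ∫ τ, h (φ.toFun τ) ∂(T.haar lam).meas u = ∫ τ, h τ ∂(T'.haar lam).meas (φ.unitMap u) := by
  have hr : ∀ τ : S, rng τ = (u : S) → rng (φ.toFun τ) = (φ.unitMap u : S') := fun τ hτ => by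
    rw [← map_rng, hτ]; rfl
  let j : Fib u → Fib (φ.unitMap u) := fun τ => ⟨φ.toFun τ, hr τ τ.2⟩
  have hj : Continuous j := (φ.continuous.comp continuous_subtype_val).subtype_mk _
  have hs' : HasCompactSupport fun x : Fib u => h (φ.toFun x) := by
    have hK := φ.isCompact_preimage (hs.isCompact.image continuous_subtype_val)
    refine HasCompactSupport.intro
      ((isClosed_fib u).isClosedEmbedding_subtypeVal.isCompact_preimage hK) fun x hx => ?_
    by_contra h0
    exact hx ⟨j x, subset_tsupport _ h0, rfl⟩
  have hu : rngU (T'.proj (φ.unitMap u : S')) = rngU (T.proj (u : S)) := Subtype.ext <| by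
    show rng (T'.proj (φ.toFun u)) = rng (T.proj (u : S))
    rw [φ.proj_map]
  rw [T.integral_haar lam (fun τ => h (φ.toFun τ)) u (hc.comp hj) hs',
    T'.integral_haar lam h (φ.unitMap u) hc hs, hu]
  refine integral_congr_ae ?_
  filter_upwards [lam.ae_fib (rngU (T.proj u))] with γ hγ
  have h0 : rng (T.sec γ) = u := (T.rng_eq_iff _ u).2 (by rw [T.proj_sec, hγ])
  have h1 := T.avg_of_invariant (h := fun τ => h (φ.toFun τ)) (σ := T.sec γ) fun α => by
    rw [φ.map_act, hi _ _ (hr _ h0)]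
  have h2 := T'.avg_of_invariant (h := h) (σ := φ.toFun (T.sec γ)) fun α => hi α _ (hr _ h0)
  rw [φ.proj_map, T.proj_sec] at h2
  rw [T.proj_sec] at h1
  rw [h1, h2]

theorem integral_comp_real (h : S' → ℝ) (u : unitSpace S)
    (hc : Continuous fun x : Fib (φ.unitMap u) => h x)
    (hs : HasCompactSupport fun x : Fib (φ.unitMap u) => h x)
    (hi : ∀ (α : Γ') (τ : S'), rng τ = (φ.unitMap u : S') → h (T'.act α τ) = h τ) :
    ∫ τ, h (φ.toFun τ) ∂(T.haar lam).meas u = ∫ τ, h τ ∂(T'.haar lam).meas (φ.unitMap u) := by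
  have key := φ.integral_comp lam (fun τ => (h τ : ℂ)) u (Complex.continuous_ofReal.comp hc)
    (hs.comp_left (g := fun r : ℝ => (r : ℂ)) Complex.ofReal_zero)
    fun α τ hτ => by rw [hi α τ hτ]
  exact Complex.ofReal_injective (integral_ofReal.symm.trans (key.trans integral_ofReal))

/-- Composition with a morphism of twists, `f' ↦ f' ∘ φ`. -/
def pullback : T'.Cc lam χ' →⋆ₙₐ[ℂ] T.Cc lam (χ'.comp θ) where
  toFun f := ⟨(⟨⟨fun σ => f (φ.toFun σ),
      (f : ConvAlg (T'.haar lam)).continuous.comp φ.continuous⟩,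
      HasCompactSupport.intro
        (φ.isCompact_preimage (f : ConvAlg (T'.haar lam)).hasCompactSupport.isCompact)
        fun _ hσ => image_eq_zero_of_notMem_tsupport (f := (f : ConvAlg (T'.haar lam))) hσ⟩ : C_c(S, ℂ)), fun α σ => by
    show f (φ.toFun (T.act α σ)) = (χ' (θ α) : ℂ) * f (φ.toFun σ)
    rw [φ.map_act]
    exact f.2 (θ α) _⟩
  map_smul' _ _ := rfl
  map_zero' := rfl
  map_add' _ _ := rfl
  map_mul' f g := Subtype.ext <| ConvAlg.ext fun σ => by
    have hr := φ.rngU_map σ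
    have hcc := HaarSystem.conv_integrand (f : ConvAlg (T'.haar lam)).toCc
      (g : ConvAlg (T'.haar lam)).toCc (φ.toFun σ)
    rw [hr] at hcc
    have key := φ.integral_comp lam (fun τ => f τ * g (ginv τ ⋄ φ.toFun σ)) (rngU σ)
      hcc.1 hcc.2 fun α τ hτ => mul_integrand_act f g α τ _ (hτ.trans (φ.map_rng σ))
    have h1 : ((f : ConvAlg (T'.haar lam)) * (g : ConvAlg (T'.haar lam))) (φ.toFun σ) =
        ∫ τ, f τ * g (ginv τ ⋄ φ.toFun σ) ∂(T'.haar lam).meas (φ.unitMap (rngU σ)) := by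
      rw [ConvAlg.mul_apply, hr]; rfl
    refine h1.trans (key.symm.trans (integral_congr_ae ?_))
    filter_upwards [(T.haar lam).ae_fib (rngU σ)] with τ hτ
    have hτ' : src (ginv τ) = rng σ := by rw [src_ginv, hτ]; rfl
    show f (φ.toFun τ) * g (ginv (φ.toFun τ) ⋄ φ.toFun σ) =
      f (φ.toFun τ) * g (φ.toFun (ginv τ ⋄ σ))
    rw [(φ.hom _ _ hτ').2, φ.map_ginv]
  map_star' f := Subtype.ext <| ConvAlg.ext fun σ => by
    show starRingEnd ℂ (f (ginv (φ.toFun σ))) = starRingEnd ℂ (f (φ.toFun (ginv σ)))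
    rw [φ.map_ginv]

theorem pullback_apply (f : T'.Cc lam χ') (σ : S) :
    φ.pullback lam χ' f σ = f (φ.toFun σ) := rfl

theorem pullback_injective : Function.Injective (φ.pullback lam χ') := by
  intro f g h
  refine DFunLike.ext _ _ fun σ' => ?_
  obtain ⟨α', σ, rfl⟩ := φ.exists_act_map σ'
  have h1 : f (φ.toFun σ) = g (φ.toFun σ) := congrArg (fun k : T.Cc lam _ => k σ) h
  have hf : f (T'.act α' (φ.toFun σ)) = χ' α' * f (φ.toFun σ) := f.2 α' _
  have hg : g (T'.act α' (φ.toFun σ)) = χ' α' * g (φ.toFun σ) := g.2 α' _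
  rw [hf, hg, h1]

/-- The function `(α', σ) ↦ χ'(α') f(σ)` on `Γ' × S` descends to `S'`. -/
theorem pullback_surjective : Function.Surjective (φ.pullback lam χ') := by
  intro f
  let q : Γ' × S → S' := fun p => T'.act p.1 (φ.toFun p.2)
  have hq : IsQuotientMap q := φ.isQuotientMap_act
  let F : Γ' × S → ℂ := fun p => χ' p.1 * f p.2
  have hF : Continuous F := ((continuous_coe_character χ').comp continuous_fst).mul
    ((f : ConvAlg (T.haar lam)).continuous.comp continuous_snd)
  -- freeness of the action of `Γ'` makes the descended function well defined
  have hwd : ∀ a b, q a = q b → F a = F b := by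
    rintro ⟨α', σ⟩ ⟨β', τ⟩ h
    have h : T'.act α' (φ.toFun σ) = T'.act β' (φ.toFun τ) := h
    have hp : T.proj σ = T.proj τ := by
      have := congrArg T'.proj h
      rwa [T'.proj_act, T'.proj_act, φ.proj_map, φ.proj_map] at this
    obtain ⟨α, rfl⟩ := T.exists_act σ τ hp
    rw [φ.map_act, T'.act_act] at h
    have hα : α' = β' * θ α := T'.act_left_injective _ h
    have hf : f (T.act α σ) = χ' (θ α) * f σ := f.2 α σ
    show (χ' α' : ℂ) * f σ = χ' β' * f (T.act α σ)
    rw [hf, hα, map_mul, Circle.coe_mul, mul_assoc]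
  let F' : S' → ℂ := fun σ' => F (Function.surjInv hq.surjective σ')
  have hF' : ∀ p, F' (q p) = F p := fun p => hwd _ _ (Function.surjInv_eq hq.surjective (q p))
  have hFc : Continuous F' := by
    rw [hq.continuous_iff]
    exact hF.congr fun p => (hF' p).symm
  have hFs : HasCompactSupport F' := by
    refine HasCompactSupport.intro ((isCompact_univ.prod
      (f : ConvAlg (T.haar lam)).hasCompactSupport.isCompact).image hq.continuous) fun σ' hσ' => ?_
    by_contra h0
    exact hσ' ⟨Function.surjInv hq.surjective σ',
      ⟨mem_univ _, subset_tsupport _ (right_ne_zero_of_mul h0)⟩, Function.surjInv_eq _ _⟩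
  refine ⟨⟨(⟨⟨F', hFc⟩, hFs⟩ : C_c(S', ℂ)), fun β' σ' => ?_⟩, ?_⟩
  · obtain ⟨⟨α', σ⟩, rfl⟩ := hq.surjective σ'
    have h1 : T'.act β' (q (α', σ)) = q (β' * α', σ) := T'.act_act _ _ _
    show F' (T'.act β' (q (α', σ))) = χ' β' * F' (q (α', σ))
    rw [h1, hF', hF']
    show (χ' (β' * α') : ℂ) * f σ = χ' β' * (χ' α' * f σ)
    rw [map_mul, Circle.coe_mul, mul_assoc]
  · refine DFunLike.ext _ _ fun σ => ?_
    have h1 : q (1, σ) = φ.toFun σ := T'.act_one _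
    show F' (φ.toFun σ) = f σ
    rw [← h1, hF']
    show (χ' 1 : ℂ) * f σ = f σ
    rw [map_one, Circle.coe_one, one_mul]

/-- The `*`-isomorphism `f ↦ f'`, inverse to composition with the morphism of twists. -/
def transfer : T.Cc lam (χ'.comp θ) ≃⋆ₐ[ℂ] T'.Cc lam χ' :=
  (StarAlgEquiv.ofBijective (φ.pullback lam χ')
    ⟨φ.pullback_injective lam χ', φ.pullback_surjective lam χ'⟩).symm

theorem pullback_transfer (f : T.Cc lam (χ'.comp θ)) :
    φ.pullback lam χ' (φ.transfer lam χ' f) = f :=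
  (StarAlgEquiv.ofBijective (φ.pullback lam χ') _).apply_symm_apply f

theorem transfer_apply_map (f : T.Cc lam (χ'.comp θ)) (σ : S) :
    φ.transfer lam χ' f (φ.toFun σ) = f σ :=
  congrArg (fun k : T.Cc lam (χ'.comp θ) => k σ) (φ.pullback_transfer lam χ' f)

/-! ### Invariance of the norms -/

variable {lam χ'}

theorem _root_.Twist.norm_apply_act (f : T'.Cc lam χ') (α : Γ') (τ : S') : ‖f (T'.act α τ)‖ = ‖f τ‖ := by
  have h : f (T'.act α τ) = χ' α * f τ := f.2 α τ
  rw [h, norm_mul, Circle.norm_coe, one_mul]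

theorem integral_norm_pullback (f : T'.Cc lam χ') (u : unitSpace S) :
    ∫ τ, ‖φ.pullback lam χ' f τ‖ ∂(T.haar lam).meas u =
      ∫ τ, ‖f τ‖ ∂(T'.haar lam).meas (φ.unitMap u) := by
  have hc := (f : ConvAlg (T'.haar lam)).continuous
  have hs := (f : ConvAlg (T'.haar lam)).hasCompactSupport
  exact φ.integral_comp_real lam (fun τ => ‖f τ‖) u (hc.norm.comp continuous_subtype_val)
    (hs.norm.comp_isClosedEmbedding (isClosed_fib _).isClosedEmbedding_subtypeVal)
    fun α τ _ => norm_apply_act f α τ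

theorem integral_norm_measInv_pullback (f : T'.Cc lam χ') (u : unitSpace S) :
    ∫ τ, ‖φ.pullback lam χ' f τ‖ ∂(T.haar lam).measInv u =
      ∫ τ, ‖f τ‖ ∂(T'.haar lam).measInv (φ.unitMap u) := by
  have h1 := φ.integral_norm_pullback (star f) u
  rw [HaarSystem.integral_measInv, HaarSystem.integral_measInv,
    (T.haar lam).integral_fm u fun ρ => ‖φ.pullback lam χ' f (ginv ρ)‖,
    (T'.haar lam).integral_fm (φ.unitMap u) fun ρ => ‖f (ginv ρ)‖]
  have h2 : ∀ τ, ‖star f τ‖ = ‖f (ginv τ)‖ := fun τ => RCLike.norm_conj (f (ginv τ))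
  have h3 : ∀ τ, ‖φ.pullback lam χ' (star f) τ‖ = ‖φ.pullback lam χ' f (ginv τ)‖ := fun τ => by
    rw [pullback_apply, pullback_apply, h2, φ.map_ginv]
  simp_rw [h2, h3] at h1
  exact h1

theorem iNorm_pullback (f : T'.Cc lam χ') :
    (T.haar lam).iNorm (φ.pullback lam χ' f : ConvAlg (T.haar lam)) =
      (T'.haar lam).iNorm (f : ConvAlg (T'.haar lam)) := by
  refine congrArg₂ max ?_ ?_
  · rw [← φ.unitMap_surjective.iSup_comp]
    exact iSup_congr fun u => φ.integral_norm_measInv_pullback f u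
  · rw [← φ.unitMap_surjective.iSup_comp]
    exact iSup_congr fun u => φ.integral_norm_pullback f u

theorem norm_toL2_pullback (f : T'.Cc lam χ') (u : unitSpace S) :
    ‖(T.haar lam).toL2 u (φ.pullback lam χ' f : ConvAlg (T.haar lam))‖ =
      ‖(T'.haar lam).toL2 (φ.unitMap u) (f : ConvAlg (T'.haar lam))‖ := by
  have hcc := (T'.haar lam).fib_ginv_cc (φ.unitMap u) (f : ConvAlg (T'.haar lam))
  have hc : Continuous fun ρ : Fib (φ.unitMap u) => ‖f (ginv (ρ : S'))‖ ^ 2 := hcc.1.norm.pow 2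
  have hs : HasCompactSupport fun ρ : Fib (φ.unitMap u) => ‖f (ginv (ρ : S'))‖ ^ 2 :=
    hcc.2.comp_left (g := fun z : ℂ => ‖z‖ ^ 2) (by simp)
  have key := φ.integral_comp_real lam (fun τ => ‖f (ginv τ)‖ ^ 2) u hc hs
    fun α τ _ => by rw [T'.ginv_act, norm_apply_act]
  rw [← (T'.haar lam).integral_fm (φ.unitMap u) fun ρ => ‖f (ginv ρ)‖ ^ 2,
    ← (T.haar lam).integral_fm u fun ρ => ‖f (ginv (φ.toFun ρ))‖ ^ 2] at key
  simp_rw [← φ.map_ginv] at key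
  refine (sq_eq_sq₀ (norm_nonneg _) (norm_nonneg _)).1 ?_
  rw [(T.haar lam).norm_sq_toL2, (T'.haar lam).norm_sq_toL2]
  exact key

theorem norm_ind_pullback (f : T'.Cc lam χ') (u : unitSpace S) :
    ‖(T.haar lam).ind u (φ.pullback lam χ' f : ConvAlg (T.haar lam))‖ =
      ‖(T'.haar lam).ind (φ.unitMap u) (f : ConvAlg (T'.haar lam))‖ := by
  have h : ∀ C : ℝ, 0 ≤ C →
      (‖(T.haar lam).ind u (φ.pullback lam χ' f : ConvAlg (T.haar lam))‖ ≤ C ↔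
        ‖(T'.haar lam).ind (φ.unitMap u) (f : ConvAlg (T'.haar lam))‖ ≤ C) := fun C hC => by
    rw [norm_ind_le_iff u _ hC, norm_ind_le_iff _ _ hC]
    refine (φ.pullback_surjective lam χ').forall.trans (forall_congr' fun g => ?_)
    rw [← map_mul, norm_toL2_pullback, norm_toL2_pullback]
  exact le_antisymm ((h _ (norm_nonneg _)).2 le_rfl) ((h _ (norm_nonneg _)).1 le_rfl)

theorem _root_.Twist.reducedNorm_apply {χ : Γ →ₜ* Circle} (f : T.Cc lam χ) :
    (T.reducedNorm lam χ).toSeminorm f =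
      ⨆ u, ‖(T.haar lam).ind u (f : ConvAlg (T.haar lam))‖ := rfl

theorem reducedNorm_pullback (f : T'.Cc lam χ') :
    (T.reducedNorm lam (χ'.comp θ)).toSeminorm (φ.pullback lam χ' f) =
      (T'.reducedNorm lam χ').toSeminorm f := by
  rw [reducedNorm_apply, reducedNorm_apply, ← φ.unitMap_surjective.iSup_comp]
  exact iSup_congr fun u => φ.norm_ind_pullback f u

end Transfer
end Morphism
end Twist

/-- Transport of a bounded representation along a `*`-isomorphism. -/
def IRep.comap {A B : Type u} [NonUnitalRing A] [StarRing A] [Module ℂ A] [NonUnitalRing B]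
    [StarRing B] [Module ℂ B] {I : A → ℝ} {J : B → ℝ} (L : IRep B J) (e : A →⋆ₙₐ[ℂ] B)
    (h : ∀ a, J (e a) ≤ I a) : IRep A I where
  K := L.K
  L := L.L.comp e
  bound a := (L.bound (e a)).trans (h a)

/-- The supremum over all representations is monotone under `*`-homomorphisms that decrease the
bounds. -/
theorem IRep.ofSup_le {A B : Type u} [NonUnitalRing A] [StarRing A] [Module ℂ A] [NonUnitalRing B]
    [StarRing B] [Module ℂ B] {I : A → ℝ} {J : B → ℝ} (e : A →⋆ₙₐ[ℂ] B)
    (h : ∀ a, J (e a) ≤ I a) (a : A) :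
    ⨆ L : IRep B J, ‖L.L (e a)‖ ≤ ⨆ L : IRep A I, ‖L.L a‖ :=
  Real.iSup_le (fun L => le_ciSup (f := fun L : IRep A I => ‖L.L a‖)
    ⟨I a, by rintro _ ⟨L, rfl⟩; exact L.bound a⟩ (L.comap e h))
    (Real.iSup_nonneg fun _ => norm_nonneg _)

namespace Twist.Morphism

variable {Γ Γ' G : Type*} {S S' : Type u}
    [CommGroup Γ] [TopologicalSpace Γ] [IsTopologicalGroup Γ] [CompactSpace Γ] [T2Space Γ]
    [MeasurableSpace Γ] [BorelSpace Γ]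
    [CommGroup Γ'] [TopologicalSpace Γ'] [IsTopologicalGroup Γ'] [CompactSpace Γ'] [T2Space Γ']
    [MeasurableSpace Γ'] [BorelSpace Γ']
    [TopologicalSpace G] [T2Space G] [LocallyCompactSpace G] [MeasurableSpace G] [BorelSpace G]
    [ArrowGroupoid G] [IsTopologicalGroupoid G]
    [TopologicalSpace S] [T2Space S] [LocallyCompactSpace S] [MeasurableSpace S] [BorelSpace S]
    [ArrowGroupoid S] [IsTopologicalGroupoid S]
    [TopologicalSpace S'] [T2Space S'] [LocallyCompactSpace S'] [MeasurableSpace S'] [BorelSpace S']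
    [ArrowGroupoid S'] [IsTopologicalGroupoid S']
    {T : Twist Γ G S} {T' : Twist Γ' G S'} {θ : Γ →ₜ* Γ'} (φ : Morphism T T' θ)
    {lam : HaarSystem G} {χ' : Γ' →ₜ* Circle}

theorem _root_.Twist.fullNorm_apply {χ : Γ →ₜ* Circle} (f : T.Cc lam χ) :
    (T.fullNorm lam χ).toSeminorm f = ⨆ L : T.Rep lam χ, ‖L.L f‖ := rfl

theorem fullNorm_transfer (f : T.Cc lam (χ'.comp θ)) :
    (T'.fullNorm lam χ').toSeminorm (φ.transfer lam χ' f) =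
      (T.fullNorm lam (χ'.comp θ)).toSeminorm f := by
  have hI : ∀ f, (T'.haar lam).iNorm (φ.transfer lam χ' f : ConvAlg (T'.haar lam)) =
      (T.haar lam).iNorm (f : ConvAlg (T.haar lam)) := fun f => by
    rw [← φ.iNorm_pullback, φ.pullback_transfer]
  rw [fullNorm_apply, fullNorm_apply]
  refine le_antisymm ?_ ?_
  · exact IRep.ofSup_le (φ.transfer lam χ' : T.Cc lam (χ'.comp θ) →⋆ₙₐ[ℂ] T'.Cc lam χ')
      (fun f => (hI f).le) f
  · have h := IRep.ofSup_le (φ.pullback lam χ')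
      (I := fun f : T'.Cc lam χ' => (T'.haar lam).iNorm (f : ConvAlg (T'.haar lam)))
      (J := fun f : T.Cc lam (χ'.comp θ) => (T.haar lam).iNorm (f : ConvAlg (T.haar lam)))
      (fun f => (φ.iNorm_pullback f).le) (φ.transfer lam χ' f)
    rwa [φ.pullback_transfer] at h

end Twist.Morphism

end

theorem theorem6p3 {Γ Γ' G : Type*} {S S' : Type u}
    [CommGroup Γ] [TopologicalSpace Γ] [IsTopologicalGroup Γ] [CompactSpace Γ] [T2Space Γ]
    [MeasurableSpace Γ] [BorelSpace Γ]
    [CommGroup Γ'] [TopologicalSpace Γ'] [IsTopologicalGroup Γ'] [CompactSpace Γ'] [T2Space Γ']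
    [MeasurableSpace Γ'] [BorelSpace Γ']
    [TopologicalSpace G] [T2Space G] [LocallyCompactSpace G] [MeasurableSpace G] [BorelSpace G]
    [ArrowGroupoid G] [IsTopologicalGroupoid G]
    [TopologicalSpace S] [T2Space S] [LocallyCompactSpace S] [MeasurableSpace S] [BorelSpace S]
    [ArrowGroupoid S] [IsTopologicalGroupoid S]
    [TopologicalSpace S'] [T2Space S'] [LocallyCompactSpace S'] [MeasurableSpace S'] [BorelSpace S']
    [ArrowGroupoid S'] [IsTopologicalGroupoid S']
    (lam : HaarSystem G) (T : Twist Γ G S) (T' : Twist Γ' G S')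
    (θ : Γ →ₜ* Γ') (θ₁ : S → S') (hθ₁ : Continuous θ₁) (hθ₁_hom : IsGroupoidHom θ₁)
    (h_incl : ∀ (u : unitSpace G) (α : Γ), θ₁ (T.incl (u, α)) = T'.incl (u, θ α))
    (h_proj : ∀ σ : S, T'.proj (θ₁ σ) = T.proj σ)
    (χ' : Γ' →ₜ* Circle) (χ : Γ →ₜ* Circle) (hχ : χ = χ'.comp θ) :
    (∀ f : T.Cc lam χ, ∃! f' : T'.Cc lam χ', ∀ σ : S, f' (θ₁ σ) = f σ) ∧
    ∃ Υ : T.Cc lam χ ≃⋆ₐ[ℂ] T'.Cc lam χ',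
      (∀ (f : T.Cc lam χ) (σ : S), Υ f (θ₁ σ) = f σ) ∧
      (∃ Φ : T.FullCStar lam χ ≃⋆ₐ[ℂ] T'.FullCStar lam χ',
        ∀ f : T.Cc lam χ, Φ (T.toFull lam χ f) = T'.toFull lam χ' (Υ f)) ∧
      (∃ Φr : T.ReducedCStar lam χ ≃⋆ₐ[ℂ] T'.ReducedCStar lam χ',
        ∀ f : T.Cc lam χ, Φr (T.toReduced lam χ f) = T'.toReduced lam χ' (Υ f)) := by

  subst hχ
  let φ : Twist.Morphism T T' θ := ⟨θ₁, hθ₁, hθ₁_hom, h_incl, h_proj⟩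
  refine ⟨fun f => ⟨φ.transfer lam χ' f, φ.transfer_apply_map lam χ' f, fun g hg => ?_⟩,
    φ.transfer lam χ', φ.transfer_apply_map lam χ',
    CStarSeminorm.exists_compl_equiv _ φ.fullNorm_transfer,
    CStarSeminorm.exists_compl_equiv _ fun f => ?_⟩
  · refine φ.pullback_injective lam χ' (DFunLike.ext _ _ fun σ => ?_)
    rw [φ.pullback_transfer]
    exact hg σ
  · rw [← φ.reducedNorm_pullback, φ.pullback_transfer]
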